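/- Let $(W,S)$ be a Coxeter system with $W$ a finite group, with Coxeter matrix $(m_{st})_{s,t\in S}$ and length function $\ell$. The $0$-Hecke monoid $\mathcal H(W)$ is the monoid generated by elements $e_s$ ($s\in S$) subject to $e_s^2=e_s$ and the braid relations $e_se_te_s\cdots=e_te_se_t\cdots$ ($m_{st}$ factors on each side, for all $s\neq t$). For $w\in W$ with reduced expression $w=s_1\cdots s_{\ell(w)}$ put $z_w=e_{s_1}\cdots e_{s_{\ell(w)}}\in\mathcal H(W)$; this does not depend on the reduced expression. For $J\subseteq S$ let $W_J=\langle J\rangle$, let $w_J$ be its longest element and let $e_J=z_{w_J}$. Write $e_0=e_S$ and, for $s\in S$, $(s)=S\setminus\{s\}$. Let $\Bbbk$ be a field. A linear representation of $\mathcal H(W)$ on a $\Bbbk$-vector space $M$ is called effective if the monoid homomorphism $\mathcal H(W)\to\operatorname{End}_{\Bbbk}(M)$ is injective. Then: 1. The left $\Bbbk\mathcal H(W)$-module $$P=\bigoplus_{s\in S}\Bbbk\mathcal H(W)(e_{(s)}-e_0)$$ is projective, and every effective $\mathcal H(W)$-module $M$ over $\Bbbk$ (of finite or infinite dimension) contains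 a $\Bbbk\mathcal H(W)$-submodule isomorphic to $P$. 2. The minimal dimension of an effective linear representation of $\mathcal H(W)$ over $\Bbbk$ is $$\sum_{s\in S}[W:W_{(s)}]-|S|.$$ -/

import Mathlib

/-- Defining relations of the `0`-Hecke monoid of the Coxeter matrix `M`: the generators are
idempotent and satisfy the braid relations
`s t s ⋯ = t s t ⋯` (`M s t` factors on either side). The entry `M s t = 0` encodes `m(s,t) = ∞`,
and then both words are empty, so no relation is imposed. -/
inductive ZeroHeckeRel {B : Type*} (M : CoxeterMatrix B) : FreeMonoid B → FreeMonoid B → Prop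
  | idem (s : B) : ZeroHeckeRel M (FreeMonoid.of s * FreeMonoid.of s) (FreeMonoid.of s)
  | braid (s t : B) : ZeroHeckeRel M (FreeMonoid.ofList (CoxeterSystem.braidWord M s t))
      (FreeMonoid.ofList (CoxeterSystem.braidWord M t s))

/-- The `0`-Hecke monoid, given by generators and relations. -/
abbrev ZeroHeckeMonoid {B : Type*} (M : CoxeterMatrix B) : Type _ :=
  PresentedMonoid (ZeroHeckeRel M)

/-- The idempotent generator `e_s` of the `0`-Hecke monoid. -/
def ZeroHeckeMonoid.gen {B : Type*} (M : CoxeterMatrix B) (s : B) : ZeroHeckeMonoid M :=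
  PresentedMonoid.of (ZeroHeckeRel M) s

namespace CoxeterSystem

/-- The standard parabolic subgroup `W_J` generated by the simple reflections in `J`. -/
def parabolic {B W : Type*} [Group W] {M : CoxeterMatrix B} (cs : CoxeterSystem M W)
    (J : Set B) : Subgroup W :=
  Subgroup.closure (cs.simple '' J)

/-- The element `z_w` of the `0`-Hecke monoid: the product of the generators `e_s` along a reduced
word of `w` (any two reduced words of `w` are related by braid relations, so the
choice of the reduced word does not matter). -/
noncomputable def zeroHecke {B W : Type*} [Group W] {M : CoxeterMatrix B}
    (cs : CoxeterSystem M W) (w : W) : ZeroHeckeMonoid M :=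
  ((cs.exists_isReduced w).choose.map (ZeroHeckeMonoid.gen M)).prod

theorem exists_longest {B W : Type*} [Group W] [Finite W] {M : CoxeterMatrix B}
    (cs : CoxeterSystem M W) (J : Set B) :
    ∃ w ∈ cs.parabolic J, ∀ v ∈ cs.parabolic J, cs.length v ≤ cs.length w :=
  Set.exists_max_image (cs.parabolic J : Set W) cs.length (Set.toFinite _)
    ⟨1, (cs.parabolic J).one_mem⟩

/-- The longest element `w_J` of the parabolic subgroup `W_J` of a finite Coxeter group. -/
noncomputable def longest {B W : Type*} [Group W] [Finite W] {M : CoxeterMatrix B}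
    (cs : CoxeterSystem M W) (J : Set B) : W :=
  (cs.exists_longest J).choose

/-- The idempotent `e_J = z_{w_J}` of the `0`-Hecke monoid of a finite Coxeter group. For `J` the
whole set of generators this is the zero element `e_0` of the monoid. -/
noncomputable def idem {B W : Type*} [Group W] [Finite W] {M : CoxeterMatrix B}
    (cs : CoxeterSystem M W) (J : Set B) : ZeroHeckeMonoid M :=
  cs.zeroHecke (cs.longest J)

/-- The left ideal `k H(W) (e_{(s)} - e_0)` of the monoid algebra `k H(W)`, where
`(s) = S \ {s}`. -/
noncomputable def projIdeal {B W : Type*} [Group W] [Finite W] {M : CoxeterMatrix B}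
    (cs : CoxeterSystem M W) (k : Type*) [Field k] (s : B) :
    Submodule (MonoidAlgebra k (ZeroHeckeMonoid M)) (MonoidAlgebra k (ZeroHeckeMonoid M)) :=
  Submodule.span (MonoidAlgebra k (ZeroHeckeMonoid M))
    {MonoidAlgebra.of k (ZeroHeckeMonoid M) (cs.idem {s}ᶜ) -
      MonoidAlgebra.of k (ZeroHeckeMonoid M) (cs.idem Set.univ)}

end CoxeterSystem

/-- There is an effective (injective) linear representation over `k` of dimension `d` of the
monoid `H`. -/
def HasEffectiveRepOfDim.{u, v} (k : Type u) [Field k] (H : Type v) [Monoid H] (d : ℕ) : Prop :=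
  ∃ (V : Type u) (_ : AddCommGroup V) (_ : Module k V) (ρ : Representation k H V),
    Function.Injective ρ ∧ Module.rank k V = (d : Cardinal)

/-!
# Effective representations of the `0`-Hecke monoid of a finite Coxeter group

The proof rests on the Frobenius structure of the monoid algebra `A = k H(W)`. Write `w₀` for the
longest element of `W`.

*The monoid.* The elements `z_w` are pairwise distinct and exhaust `H(W)`, and multiplying `z_w` by a
generator `e_s` either fixes it or moves it to the longer `z_{sw}`. That `z_w` is independent of the
reduced word is the theorem of Matsumoto and Tits (`CoxeterSystem.prod_map_eq_of_isReduced`), which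
needs the exchange condition (`CoxeterSystem.exists_simple_mul_wordProd_eq_eraseIdx`) and the fact
that `s t` has order exactly `m(s, t)`, read off from the geometric representation
(`CoxeterSystem.simple_mul_simple_pow_ne_one`). Distinctness follows from the homomorphism to the
subsets of `W` with `e_s ↦ {1, s}`: the image of `z_w` has `w` as its only element of maximal length.

*The Frobenius form.* The coefficient of `e_0 = z_{w₀}` is a linear functional on `A` that vanishes
on no nonzero left ideal (`CoxeterSystem.exists_topCoeff_of_mul_ne_zero`), and moving a generator
from the right factor to the left one twists it by `s ↦ w₀ s w₀`
(`CoxeterSystem.topCoeff_mul_of_gen`). Hence a vector of `A` on which every generator acts by `0` or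
`1` is determined, up to a scalar, by these eigenvalues. In the left ideal
`P_s = A (e_{(s)} - e_0)` the right action of the generators is constrained so much that only one
system of eigenvalues occurs, that of `z_{w₀ s} - e_0`; it differs for different `s`
(`CoxeterSystem.eq_smul_socleGenerator`).

*The embedding.* In any module, a nonzero vector has a nonzero multiple on which every generator acts
by `0` or `1` (`CoxeterSystem.exists_smul_eigenvector`). In an effective module `V` no
`z_{w₀ s} - e_0` acts as zero, so there are vectors `v_s` with `(z_{w₀ s} - e_0) v_s ≠ 0`. The kernel
of the map `(x_s) ↦ ∑ x_s v_s` from `⨁ P_s` to `V` contains no eigenvector of the above kind, because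
such a vector is a multiple of a single `z_{w₀ s} - e_0`. So the map is injective
(`CoxeterSystem.exists_injective_directSum`).

*The dimension.* The elements of `H(W) e_J` correspond to the cosets of `W_J`, so `P_s` has dimension
`[W : W_{(s)}] - 1`. For the same reason two elements `z_u`, `z_v` that act equally on `⨁ P_s` satisfy
`u⁻¹ v ∈ ⋂ W_{(s)} = 1`, so `⨁ P_s` is itself effective. It is projective since `e_{(s)} - e_0` is
idempotent.
-/

/-! ### The geometric representation -/

namespace CoxeterMatrix

open Module Polynomial.Chebyshev

variable {B : Type*} (M : CoxeterMatrix B)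

/-- The coroot functional of the geometric representation: it sends the simple root `α_j` to
`-2 cos (π / m(i, j))`. The convention `π / 0 = 0` yields the value `-2` for `m(i, j) = ∞`. -/
noncomputable def geomCoroot (i : B) : Dual ℝ (B →₀ ℝ) :=
  Finsupp.linearCombination ℝ fun j => -2 * Real.cos (Real.pi / M i j)

theorem geomCoroot_single (i j : B) :
    M.geomCoroot i (Finsupp.single j 1) = -2 * Real.cos (Real.pi / M i j) := by
  simp [geomCoroot]

theorem geomCoroot_self (i : B) : M.geomCoroot i (Finsupp.single i 1) = 2 := by
  simp [geomCoroot_single]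

/-- The reflection by which a simple generator acts in the geometric representation. -/
noncomputable def geomReflection (i : B) : (B →₀ ℝ) ≃ₗ[ℝ] (B →₀ ℝ) :=
  reflection (M.geomCoroot_self i)

theorem geomCoroot_mul_sub_two (i j : B) :
    M.geomCoroot i (Finsupp.single j 1) * M.geomCoroot j (Finsupp.single i 1) - 2 =
      2 * Real.cos (2 * (Real.pi / M i j)) := by
  rw [geomCoroot_single, geomCoroot_single, M.symmetric j i, Real.cos_two_mul]
  ring

theorem sin_two_pi_div_pos {m : ℕ} (hm : 3 ≤ m) : 0 < Real.sin (2 * (Real.pi / m)) := by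
  have h3 : (3 : ℝ) ≤ m := by exact_mod_cast hm
  apply Real.sin_pos_of_pos_of_lt_pi
  · positivity
  · rw [← mul_div_assoc, div_lt_iff₀ (by linarith)]
    nlinarith [Real.pi_pos]

theorem isLiftable_geomReflection : M.IsLiftable M.geomReflection := by
  intro i j
  obtain h0 | h1 | h2 | h3 : M i j = 0 ∨ M i j = 1 ∨ M i j = 2 ∨ 3 ≤ M i j := by omega
  · simp [h0]
  · obtain rfl : i = j := by
      by_contra h
      exact M.off_diagonal i j h h1
    rw [h1, pow_one]
    ext1 v
    exact involutive_reflection (M.geomCoroot_self i) v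
  · have hij : M.geomCoroot i (Finsupp.single j 1) = 0 := by simp [geomCoroot_single, h2]
    have hji : M.geomCoroot j (Finsupp.single i 1) = 0 := by
      simp [geomCoroot_single, M.symmetric j i, h2]
    rw [h2, pow_two]
    ext1 v
    simp only [geomReflection, LinearEquiv.mul_apply, reflection_apply, map_sub, map_smul, hij, hji,
      geomCoroot_self, LinearEquiv.coe_one, id]
    module
  · set θ := 2 * (Real.pi / M i j) with hθ
    have hs : Real.sin θ ≠ 0 := (sin_two_pi_div_pos h3).ne'
    have hmθ : (M i j : ℝ) * θ = 2 * Real.pi := by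
      have : (M i j : ℝ) ≠ 0 := by positivity
      rw [hθ]; field_simp
    have ht := M.geomCoroot_mul_sub_two i j
    ext1 v
    rw [geomReflection, geomReflection, reflection_mul_reflection_pow_apply _ _ _ _ _ ht.symm]
    -- With `m = 2 k` the factors `S (k - 1)` vanish, with `m = 2 k + 1` the sums `S k + S (k - 1)`.
    obtain ⟨k, hk | hk⟩ := Nat.even_or_odd' (M i j)
    · have hS : (S ℝ ((k : ℤ) - 1)).eval (2 * Real.cos θ) = 0 := by
        have := S_two_mul_real_cos θ ((k : ℤ) - 1)
        have hkθ : ((((k : ℤ) - 1 : ℤ) : ℝ) + 1) * θ = Real.pi := by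
          rw [hk] at hmθ; push_cast at hmθ ⊢; linarith
        rw [hkθ, Real.sin_pi] at this
        exact (mul_eq_zero.mp this).resolve_right hs
      have e1 : ((M i j : ℤ) - 2) / 2 = (k : ℤ) - 1 := by omega
      have e2 : ((M i j : ℤ) - 1) / 2 = (k : ℤ) - 1 := by omega
      rw [e1, e2, hS]
      simp
    · have hS : (S ℝ (k : ℤ)).eval (2 * Real.cos θ) +
          (S ℝ ((k : ℤ) - 1)).eval (2 * Real.cos θ) = 0 := by
        have h1 := S_two_mul_real_cos θ (k : ℤ)
        have h2 := S_two_mul_real_cos θ ((k : ℤ) - 1)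
        have e : (((k : ℤ) : ℝ) + 1) * θ = 2 * Real.pi - (((k : ℤ) - 1 : ℤ) + 1 : ℝ) * θ := by
          rw [hk] at hmθ; push_cast at hmθ ⊢; linarith
        rw [e, Real.sin_two_pi_sub, ← h2] at h1
        have : ((S ℝ (k : ℤ)).eval (2 * Real.cos θ) +
          (S ℝ ((k : ℤ) - 1)).eval (2 * Real.cos θ)) * Real.sin θ = 0 := by
          rw [add_mul, h1]; ring
        exact (mul_eq_zero.mp this).resolve_right hs
      have e1 : ((M i j : ℤ) - 2) / 2 = (k : ℤ) - 1 := by omega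
      have e2 : ((M i j : ℤ) - 1) / 2 = (k : ℤ) := by omega
      have e3 : ((M i j : ℤ) - 3) / 2 = (k : ℤ) - 1 := by omega
      have e4 : (M i j : ℤ) / 2 = (k : ℤ) := by omega
      rw [e1, e2, e3, e4, hS]
      simp

theorem geomReflection_mul_pow_ne_one {i j : B} (hij : i ≠ j) {n : ℕ} (hn : 0 < n)
    (hn' : M i j = 0 ∨ n < M i j) : (M.geomReflection i * M.geomReflection j) ^ n ≠ 1 := by
  intro h
  have ht := M.geomCoroot_mul_sub_two i j
  have key := reflection_mul_reflection_pow_apply_self (M.geomCoroot_self i)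
    (M.geomCoroot_self j) n _ ht.symm
  rw [← geomReflection, ← geomReflection, h] at key
  set θ := 2 * (Real.pi / M i j) with hθ
  have k1 : (1 : ℝ) =
      (S ℝ n).eval (2 * Real.cos θ) + (S ℝ ((n : ℤ) - 1)).eval (2 * Real.cos θ) := by
    have := DFunLike.congr_fun key i
    simpa [hij, hij.symm] using this
  have k2 : (S ℝ ((n : ℤ) - 1)).eval (2 * Real.cos θ) *
      (-M.geomCoroot j (Finsupp.single i 1)) = 0 := by
    have := DFunLike.congr_fun key j
    simpa [hij, hij.symm] using this.symm
  rw [geomCoroot_single, M.symmetric j i] at k2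
  obtain h0 | h1 | h2 | h3 : M i j = 0 ∨ M i j = 1 ∨ M i j = 2 ∨ 3 ≤ M i j := by omega
  · simp only [h0, CharP.cast_eq_zero, div_zero, Real.cos_zero, hθ, mul_zero, mul_one,
      S_eval_two] at k2
    have : (n : ℝ) ≠ 0 := by positivity
    push_cast at k2
    apply this
    linarith
  · exact M.off_diagonal i j hij h1
  · obtain rfl : n = 1 := by omega
    have hc : Real.cos θ = -1 := by rw [hθ, h2]; norm_num [mul_div_cancel₀]
    rw [hc] at k1
    norm_num at k1
  · have hs : Real.sin θ ≠ 0 := (sin_two_pi_div_pos h3).ne'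
    have hm : n < M i j := by omega
    have h3' : (3 : ℝ) ≤ M i j := by exact_mod_cast h3
    have hc : 0 < Real.cos (Real.pi / M i j) := by
      apply Real.cos_pos_of_mem_Ioo
      constructor
      · have : 0 < Real.pi / M i j := by positivity
        linarith [Real.pi_pos]
      · rw [div_lt_div_iff_of_pos_left Real.pi_pos (by linarith) (by norm_num)]
        linarith
    have z : (S ℝ ((n : ℤ) - 1)).eval (2 * Real.cos θ) = 0 :=
      (mul_eq_zero.mp k2).resolve_right (by linarith)
    have hsin : Real.sin (n * θ) = 0 := by
      have := S_two_mul_real_cos θ ((n : ℤ) - 1)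
      rw [z] at this
      simpa using this.symm
    have hcos : Real.cos (n * θ) = 1 := by
      have := S_two_mul_real_cos θ (n : ℤ)
      have e : (S ℝ (n : ℤ)).eval (2 * Real.cos θ) = 1 := by linarith
      rw [e, add_mul, one_mul, one_mul, Real.sin_add] at this
      simp only [Int.cast_natCast, hsin, zero_mul, zero_add] at this
      exact mul_right_cancel₀ hs (by linarith)
    have hlt : (n : ℝ) * θ < 2 * Real.pi := by
      rw [hθ, show (n : ℝ) * (2 * (Real.pi / M i j)) = (2 * Real.pi) * (n / M i j) by ring]
      have : (n : ℝ) / M i j < 1 := (div_lt_one (by linarith)).mpr (by exact_mod_cast hm)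
      nlinarith [Real.pi_pos]
    have hpos : 0 < (n : ℝ) * θ := by positivity
    exact hpos.ne' ((Real.cos_eq_one_iff_of_lt_of_lt (by linarith [Real.pi_pos]) hlt).mp hcos)

end CoxeterMatrix

namespace CoxeterSystem

variable {B W : Type*} [Group W] {M : CoxeterMatrix B} (cs : CoxeterSystem M W)

/-- The product of two distinct simple reflections has order exactly `m(i, j)`: the geometric
representation separates its lower powers from the identity. -/
theorem simple_mul_simple_pow_ne_one {i j : B} (hij : i ≠ j) {n : ℕ} (hn : 0 < n)
    (hn' : M i j = 0 ∨ n < M i j) : (cs.simple i * cs.simple j) ^ n ≠ 1 := by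
  intro h
  apply M.geomReflection_mul_pow_ne_one hij hn hn'
  have := congrArg (cs.lift ⟨_, M.isLiftable_geomReflection⟩) h
  simpa using this

theorem simple_injective : Function.Injective cs.simple := by
  intro i j h
  by_contra hij
  refine cs.simple_mul_simple_pow_ne_one hij one_pos ?_ (by simp [h])
  have := M.off_diagonal i j hij
  omega

end CoxeterSystem

/-! ### The exchange condition -/

namespace CoxeterSystem

variable {B W : Type*} [Group W] {M : CoxeterMatrix B} (cs : CoxeterSystem M W)

open List

open Classical in
/-- The permutation of `W × ZMod 2` by which a simple reflection `s` acts: it conjugates the first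
entry by `s`, and flips the second one when the first entry is `s`. -/
noncomputable def inversionPerm (i : B) : Equiv.Perm (W × ZMod 2) :=
  Function.Involutive.toPerm
    (fun p => (cs.simple i * p.1 * cs.simple i, p.2 + if p.1 = cs.simple i then 1 else 0)) <| by
    rintro ⟨t, a⟩
    have h : cs.simple i * t * cs.simple i = cs.simple i ↔ t = cs.simple i := by
      constructor
      · intro h
        have := congrArg (fun x => cs.simple i * x * cs.simple i) h
        simpa [mul_assoc] using this
      · rintro rfl; simp
    by_cases ht : t = cs.simple i
    · simp [ht, add_assoc, CharTwo.add_self_eq_zero]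
    · have h' := mt h.mp ht
      simp only [if_neg ht, if_neg h']
      simp [mul_assoc]

open Classical in
theorem prod_map_inversionPerm_apply (ω : List B) (t : W) (a : ZMod 2) :
    (ω.map cs.inversionPerm).prod (t, a) =
      (cs.wordProd ω * t * (cs.wordProd ω)⁻¹,
        a + ((cs.leftInvSeq ω.reverse).count t : ZMod 2)) := by
  induction ω with
  | nil => simp
  | cons i ω ih =>
    rw [map_cons, prod_cons, Equiv.Perm.mul_apply, ih, reverse_cons, ← concat_eq_append,
      leftInvSeq_concat, concat_eq_append, count_append, wordProd_reverse, inv_inv]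
    simp only [inversionPerm, Function.Involutive.toPerm, Equiv.coe_fn_mk, wordProd_cons]
    have h : cs.wordProd ω * t * (cs.wordProd ω)⁻¹ = cs.simple i ↔
        (cs.wordProd ω)⁻¹ * cs.simple i * cs.wordProd ω = t := by
      rw [mul_inv_eq_iff_eq_mul, mul_assoc, inv_mul_eq_iff_eq_mul, eq_comm]
    refine Prod.ext (by simp [mul_assoc]) ?_
    simp only [count_singleton, beq_iff_eq, h]
    split_ifs <;> simp [add_assoc]

theorem wordProd_alternatingWord_add (i j : B) (k : ℕ) :
    cs.wordProd (alternatingWord i j (2 * (k + M i j) + 1)) =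
      cs.wordProd (alternatingWord i j (2 * k + 1)) := by
  have h1 : ¬ Even (2 * (k + M i j) + 1) := by simp
  have h2 : ¬ Even (2 * k + 1) := by simp
  have e1 : (2 * (k + M i j) + 1) / 2 = k + M i j := by omega
  have e2 : (2 * k + 1) / 2 = k := by omega
  rw [prod_alternatingWord_eq_mul_pow, prod_alternatingWord_eq_mul_pow, if_neg h1, if_neg h2, e1,
    e2, pow_add, simple_mul_simple_pow, mul_one]

open Classical in
theorem even_count_leftInvSeq_alternatingWord (i j : B) (t : W) :
    Even ((cs.leftInvSeq (alternatingWord i j (2 * M i j))).count t) := by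
  -- The inversion sequence is periodic with period `M i j`, hence a list repeated twice.
  have : cs.leftInvSeq (alternatingWord i j (2 * M i j)) =
      (cs.leftInvSeq (alternatingWord i j (2 * M i j))).take (M i j) ++
      (cs.leftInvSeq (alternatingWord i j (2 * M i j))).take (M i j) := by
    apply List.ext_getElem
    · simp; omega
    · intro n h1 h2
      have h1' : n < 2 * M i j := by simpa using h1
      rw [getElem_append]
      split_ifs with h
      · simp
      · have h' : M i j ≤ n := by simp at h; omega
        simp only [getElem_take, length_take, length_leftInvSeq, length_alternatingWord]
        rw [cs.getElem_leftInvSeq_alternatingWord i j _ n h1',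
          cs.getElem_leftInvSeq_alternatingWord i j _ _ (by omega)]
        obtain ⟨k, rfl⟩ := Nat.exists_eq_add_of_le' h'
        rw [M.symmetric i j, wordProd_alternatingWord_add]
        congr 3
        omega
  rw [this, count_append]
  exact ⟨_, rfl⟩

theorem isLiftable_inversionPerm : M.IsLiftable cs.inversionPerm := by
  classical
  intro i j
  have h : ∀ n, (cs.inversionPerm i * cs.inversionPerm j) ^ n =
      ((alternatingWord i j (2 * n)).map cs.inversionPerm).prod := by
    intro n
    induction n with
    | zero => simp [alternatingWord]
    | succ n ih =>
      rw [pow_succ, ih, mul_add, mul_one]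
      simp [alternatingWord]
  rw [h]
  ext1 ⟨t, a⟩
  have hrev : (alternatingWord i j (2 * M i j)).reverse = alternatingWord j i (2 * M j i) := by
    rw [M.symmetric j i]
    generalize M i j = m
    induction m with
    | zero => simp [alternatingWord]
    | succ m ih =>
      rw [mul_add, mul_one, alternatingWord_succ', alternatingWord_succ']
      simp [alternatingWord, ih]
  have hw : cs.wordProd (alternatingWord i j (2 * M i j)) = 1 := by
    simp [prod_alternatingWord_eq_mul_pow]
  rw [prod_map_inversionPerm_apply, hrev, hw,
    (ZMod.natCast_eq_zero_iff_even).mpr (cs.even_count_leftInvSeq_alternatingWord j i t)]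
  simp

open Classical in
/-- The parity of the number of times a reflection occurs in the left inversion sequence of a word
depends on the product of the word only. -/
theorem count_leftInvSeq_eq_of_wordProd_eq {ω ω' : List B} (h : cs.wordProd ω = cs.wordProd ω')
    (t : W) : ((cs.leftInvSeq ω).count t : ZMod 2) = ((cs.leftInvSeq ω').count t : ZMod 2) := by
  have key : ∀ ω : List B, (ω.map cs.inversionPerm).prod =
      cs.lift ⟨_, cs.isLiftable_inversionPerm⟩ (cs.wordProd ω) := by
    intro ω
    rw [wordProd, map_list_prod, map_map]
    congr 1
    apply map_congr_left
    intro i _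
    simp
  have h1 := cs.prod_map_inversionPerm_apply ω.reverse t 0
  have h2 := cs.prod_map_inversionPerm_apply ω'.reverse t 0
  rw [key, wordProd_reverse] at h1 h2
  rw [h, h2] at h1
  simpa using (congrArg Prod.snd h1).symm

/-- The exchange condition: a left descent of the product of a word occurs in its inversion
sequence. -/
theorem simple_mem_leftInvSeq {ω : List B} {i : B} (h : cs.IsLeftDescent (cs.wordProd ω) i) :
    cs.simple i ∈ cs.leftInvSeq ω := by
  classical
  obtain ⟨ω', hω', hw⟩ := cs.exists_isReduced (cs.simple i * cs.wordProd ω)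
  have hprod : cs.wordProd ω = cs.wordProd (i :: ω') := by
    rw [wordProd_cons, ← hw, simple_mul_simple_cancel_left]
  have hnot : cs.simple i ∉ cs.leftInvSeq ω' := by
    intro hmem
    have := (cs.isLeftInversion_of_mem_leftInvSeq hω' hmem).2
    rw [← hw, simple_mul_simple_cancel_left] at this
    exact lt_asymm this h
  have hc := cs.count_leftInvSeq_eq_of_wordProd_eq hprod (cs.simple i)
  have hconj : MulAut.conj (cs.simple i) (cs.simple i) = cs.simple i := by simp
  have hcount : (cs.leftInvSeq (i :: ω')).count (cs.simple i) = 1 := by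
    rw [leftInvSeq, count_cons_self]
    have := count_map_of_injective (cs.leftInvSeq ω') _ (MulAut.conj (cs.simple i)).injective
      (cs.simple i)
    rw [hconj, count_eq_zero_of_not_mem hnot] at this
    rw [this]
  rw [hcount] at hc
  by_contra hmem
  rw [count_eq_zero_of_not_mem hmem] at hc
  simp at hc

theorem exists_simple_mul_wordProd_eq_eraseIdx {ω : List B} {i : B}
    (h : cs.IsLeftDescent (cs.wordProd ω) i) :
    ∃ k < ω.length, cs.simple i * cs.wordProd ω = cs.wordProd (ω.eraseIdx k) := by
  obtain ⟨k, hk, hki⟩ := List.mem_iff_getElem.mp (cs.simple_mem_leftInvSeq h)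
  refine ⟨k, by simpa using hk, ?_⟩
  rw [← getD_leftInvSeq_mul_wordProd, getD_eq_getElem _ _ hk, hki]

/-! ### Independence of the reduced word -/

/-- The alternating word of length `n` that starts with `i`. -/
def prefixAlternatingWord (i j : B) : ℕ → List B
  | 0 => []
  | n + 1 => i :: prefixAlternatingWord j i n

@[simp]
theorem length_prefixAlternatingWord (i j : B) (n : ℕ) :
    (prefixAlternatingWord i j n).length = n := by
  induction n generalizing i j with
  | zero => rfl
  | succ n ih => simp [prefixAlternatingWord, ih]

theorem alternatingWord_eq_prefixAlternatingWord (i j : B) (n : ℕ) :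
    alternatingWord i j n =
      if Even n then prefixAlternatingWord i j n else prefixAlternatingWord j i n := by
  induction n with
  | zero => simp [alternatingWord, prefixAlternatingWord]
  | succ n ih =>
    rw [alternatingWord_succ', ih]
    by_cases h : Even n <;> simp [h, Nat.even_add_one, prefixAlternatingWord]

theorem prod_map_prefixAlternatingWord_eq {N : Type*} [Monoid N] {i j : B} (g : B → N)
    (hg : ((braidWord M i j).map g).prod = ((braidWord M j i).map g).prod) :
    ((prefixAlternatingWord i j (M i j)).map g).prod =
      ((prefixAlternatingWord j i (M i j)).map g).prod := by
  rw [braidWord, braidWord, M.symmetric j i, alternatingWord_eq_prefixAlternatingWord,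
    alternatingWord_eq_prefixAlternatingWord] at hg
  split_ifs at hg
  · exact hg
  · exact hg.symm

theorem exists_eq_of_mem_leftInvSeq_prefixAlternatingWord {i j : B} {n : ℕ} {t : W}
    (h : t ∈ cs.leftInvSeq (prefixAlternatingWord i j n)) :
    ∃ k < n, t = cs.simple i * (cs.simple j * cs.simple i) ^ k := by
  induction n generalizing i j t with
  | zero => simp [prefixAlternatingWord] at h
  | succ n ih =>
    simp only [prefixAlternatingWord, leftInvSeq, mem_cons, mem_map] at h
    obtain rfl | ⟨u, hu, rfl⟩ := h
    · exact ⟨0, by simp⟩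
    · obtain ⟨k, hk, rfl⟩ := ih hu
      refine ⟨k + 1, by omega, ?_⟩
      have : (cs.simple i * cs.simple j) ^ k * cs.simple i =
          cs.simple i * (cs.simple j * cs.simple i) ^ k := by
        clear hk hu
        induction k with
        | zero => simp
        | succ k ih => rw [pow_succ', pow_succ', mul_assoc, ih]; simp [mul_assoc]
      rw [MulAut.conj_apply, inv_simple, mul_assoc, mul_assoc, this, pow_succ']
      simp [mul_assoc]

/-- An element with two left descents `i ≠ j` has reduced words that start with arbitrarily long
alternating words in `i` and `j`, up to the length `m(i, j)`. -/
theorem exists_isReduced_prefixAlternatingWord_append {w : W} {i j : B} (hij : i ≠ j)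
    (hi : cs.IsLeftDescent w i) (hj : cs.IsLeftDescent w j) (n : ℕ)
    (hn : M i j = 0 ∨ n ≤ M i j) :
    ∃ ω : List B, cs.IsReduced (prefixAlternatingWord i j n ++ ω) ∧
      cs.wordProd (prefixAlternatingWord i j n ++ ω) = w := by
  induction n generalizing i j with
  | zero =>
    obtain ⟨ω, h1, h2⟩ := cs.exists_isReduced w
    exact ⟨ω, h1, h2.symm⟩
  | succ n ih =>
    obtain ⟨ω, hω, rfl⟩ := ih hij.symm hj hi (by rw [M.symmetric]; omega)
    obtain ⟨k, hk, hki⟩ := cs.exists_simple_mul_wordProd_eq_eraseIdx hi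
    by_cases hkn : k < n
    · exfalso
      -- A letter of the alternating word is exchanged: then `i` lies in its inversion sequence.
      have hmem : cs.simple i ∈ cs.leftInvSeq (prefixAlternatingWord j i n) := by
        have h1 := cs.getD_leftInvSeq_mul_wordProd (prefixAlternatingWord j i n) k
        rw [eraseIdx_append_of_lt_length (by simpa using hkn), wordProd_append, wordProd_append,
          ← h1, ← mul_assoc] at hki
        have h2 := mul_right_cancel (mul_right_cancel hki)
        rw [h2, getD_eq_getElem _ _ (by simpa using hkn)]
        exact getElem_mem _
      obtain ⟨l, hl, hl'⟩ := cs.exists_eq_of_mem_leftInvSeq_prefixAlternatingWord hmem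
      refine cs.simple_mul_simple_pow_ne_one (n := l + 1) hij (by omega) (by omega) ?_
      have h3 : cs.simple j * cs.simple i = (cs.simple i * cs.simple j) ^ l := by
        nth_rw 1 [hl']
        rw [simple_mul_simple_cancel_left]
      rw [pow_succ, ← h3]
      simp [mul_assoc]
    · obtain ⟨k, rfl⟩ := Nat.exists_eq_add_of_le (not_lt.mp hkn)
      have hw : cs.wordProd (prefixAlternatingWord i j (n + 1) ++ ω.eraseIdx k) =
          cs.wordProd (prefixAlternatingWord j i n ++ ω) := by
        rw [eraseIdx_append_of_length_le (by simp)] at hki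
        simp only [length_prefixAlternatingWord, Nat.add_sub_cancel_left] at hki
        rw [prefixAlternatingWord, cons_append, wordProd_cons, ← hki,
          simple_mul_simple_cancel_left]
      refine ⟨ω.eraseIdx k, ?_, hw⟩
      have hk' : k < ω.length := by simpa using hk
      have hlen := length_eraseIdx_add_one hk'
      rw [IsReduced, hw, hω.eq, length_append, length_append, length_prefixAlternatingWord,
        length_prefixAlternatingWord]
      omega

/-- The theorem of Matsumoto and Tits: if elements of a monoid satisfy the braid relations, then
their products along two reduced words of the same group element agree. -/
theorem prod_map_eq_of_isReduced {N : Type*} [Monoid N] (g : B → N)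
    (hg : ∀ i j, ((braidWord M i j).map g).prod = ((braidWord M j i).map g).prod)
    {ω ω' : List B} (hω : cs.IsReduced ω) (hω' : cs.IsReduced ω')
    (h : cs.wordProd ω = cs.wordProd ω') : (ω.map g).prod = (ω'.map g).prod := by
  obtain ⟨n, hn⟩ : ∃ n, ω.length = n := ⟨_, rfl⟩
  induction n generalizing ω ω' with
  | zero =>
    have h0 : ω'.length = 0 := by rw [← hω'.eq, ← h, hω.eq, hn]
    rw [List.length_eq_zero_iff.mp hn, List.length_eq_zero_iff.mp h0]
  | succ n ih =>
    have hn' : ω'.length = n + 1 := by rw [← hω'.eq, ← h, hω.eq, hn]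
    -- The induction hypothesis settles the case of two words with the same first letter.
    have step : ∀ {i : B} {a b : List B}, cs.IsReduced (i :: a) → cs.IsReduced (i :: b) →
        cs.wordProd (i :: a) = cs.wordProd (i :: b) → a.length = n →
        ((i :: a).map g).prod = ((i :: b).map g).prod := by
      intro i a b ha hb hab hl
      rw [map_cons, map_cons, prod_cons, prod_cons,
        ih (by simpa using ha.drop 1) (by simpa using hb.drop 1)
          (by simpa [wordProd_cons] using hab) hl]
    obtain ⟨i, a, rfl⟩ := exists_cons_of_length_eq_add_one hn
    obtain ⟨j, b, rfl⟩ := exists_cons_of_length_eq_add_one hn'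
    by_cases hij : i = j
    · subst hij
      exact step hω hω' h (by simpa using hn)
    have desc : ∀ {i : B} {a : List B}, cs.IsReduced (i :: a) →
        cs.IsLeftDescent (cs.wordProd (i :: a)) i := by
      intro i a ha
      rw [IsLeftDescent, ha.eq, wordProd_cons, simple_mul_simple_cancel_left]
      exact Nat.lt_succ_of_le (cs.length_wordProd_le a)
    have hi := desc hω
    have hj := desc hω'
    rw [← h] at hj
    have hM : M i j ≠ 0 := by
      intro h0
      obtain ⟨c, hc, hc'⟩ := cs.exists_isReduced_prefixAlternatingWord_append hij hi hj (n + 2)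
        (Or.inl h0)
      have := hc.eq
      rw [hc', hω.eq, hn, length_append, length_prefixAlternatingWord] at this
      omega
    obtain ⟨c, hc, hc'⟩ := cs.exists_isReduced_prefixAlternatingWord_append hij hi hj (M i j)
      (Or.inr le_rfl)
    have hw : cs.wordProd (prefixAlternatingWord i j (M i j) ++ c) =
        cs.wordProd (prefixAlternatingWord j i (M i j) ++ c) := by
      have := prod_map_prefixAlternatingWord_eq cs.simple (cs.wordProd_braidWord_eq i j)
      rw [wordProd_append, wordProd_append]
      exact congrArg (· * cs.wordProd c) this
    have hc2 : cs.IsReduced (prefixAlternatingWord j i (M i j) ++ c) := by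
      rw [IsReduced, ← hw, hc.eq]
      simp
    have hp : ((prefixAlternatingWord i j (M i j) ++ c).map g).prod =
        ((prefixAlternatingWord j i (M i j) ++ c).map g).prod := by
      rw [map_append, map_append, prod_append, prod_append,
        prod_map_prefixAlternatingWord_eq g (hg i j)]
    obtain ⟨m, hm⟩ := Nat.exists_eq_succ_of_ne_zero hM
    simp only [hm, Nat.succ_eq_add_one, prefixAlternatingWord, cons_append] at hp hw hc hc2 hc'
    rw [step hω hc hc'.symm (by simpa using hn), hp]
    refine step hc2 hω' (by rw [← hw, hc', h]) ?_
    have := hc.eq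
    rw [hw] at this
    have h4 := hω'.eq
    rw [← h, ← hc', hw, hc2.eq] at h4
    simp only [length_cons] at h4 hn'
    omega

end CoxeterSystem

/-! ### The `0`-Hecke monoid -/

namespace ZeroHeckeMonoid

variable {B : Type*} (M : CoxeterMatrix B)

theorem gen_mul_gen (i : B) : gen M i * gen M i = gen M i :=
  PresentedMonoid.mk_eq_mk_of_rel (ZeroHeckeRel.idem i)

theorem prod_map_gen (ω : List B) :
    (ω.map (gen M)).prod = PresentedMonoid.mk (ZeroHeckeRel M) (FreeMonoid.ofList ω) := by
  induction ω with
  | nil => exact (map_one (PresentedMonoid.mk (ZeroHeckeRel M))).symm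
  | cons i ω ih =>
    rw [List.map_cons, List.prod_cons, ih, FreeMonoid.ofList_cons, map_mul]
    rfl

theorem prod_map_gen_braidWord (i j : B) :
    ((CoxeterSystem.braidWord M i j).map (gen M)).prod =
      ((CoxeterSystem.braidWord M j i).map (gen M)).prod := by
  rw [prod_map_gen, prod_map_gen]
  exact PresentedMonoid.mk_eq_mk_of_rel (ZeroHeckeRel.braid i j)

theorem closure_range_gen : Submonoid.closure (Set.range (gen M)) = ⊤ :=
  PresentedMonoid.closure_range_of _

end ZeroHeckeMonoid

namespace CoxeterSystem

open ZeroHeckeMonoid List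

variable {B W : Type*} [Group W] {M : CoxeterMatrix B} (cs : CoxeterSystem M W)

theorem zeroHecke_wordProd {ω : List B} (hω : cs.IsReduced ω) :
    cs.zeroHecke (cs.wordProd ω) = (ω.map (gen M)).prod :=
  cs.prod_map_eq_of_isReduced (gen M) (prod_map_gen_braidWord M)
    (cs.exists_isReduced (cs.wordProd ω)).choose_spec.1 hω
    (cs.exists_isReduced (cs.wordProd ω)).choose_spec.2.symm

theorem zeroHecke_one : cs.zeroHecke 1 = 1 := by
  have h : cs.IsReduced [] := by simp [IsReduced]
  simpa using cs.zeroHecke_wordProd h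

theorem gen_mul_zeroHecke_of_not_isLeftDescent {w : W} {i : B} (h : ¬ cs.IsLeftDescent w i) :
    gen M i * cs.zeroHecke w = cs.zeroHecke (cs.simple i * w) := by
  obtain ⟨ω, hω, rfl⟩ := cs.exists_isReduced w
  have h' : cs.IsReduced (i :: ω) := by
    rw [IsReduced, wordProd_cons, cs.not_isLeftDescent_iff.mp h, hω.eq, length_cons]
  rw [cs.zeroHecke_wordProd hω, ← wordProd_cons, cs.zeroHecke_wordProd h']
  simp

theorem gen_mul_zeroHecke_of_isLeftDescent {w : W} {i : B} (h : cs.IsLeftDescent w i) :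
    gen M i * cs.zeroHecke w = cs.zeroHecke w := by
  have h' := cs.gen_mul_zeroHecke_of_not_isLeftDescent
    (cs.isLeftDescent_iff_not_isLeftDescent_mul.mp h)
  rw [simple_mul_simple_cancel_left] at h'
  rw [← h', ← mul_assoc, gen_mul_gen]

theorem zeroHecke_mul_gen_of_not_isRightDescent {w : W} {i : B} (h : ¬ cs.IsRightDescent w i) :
    cs.zeroHecke w * gen M i = cs.zeroHecke (w * cs.simple i) := by
  obtain ⟨ω, hω, rfl⟩ := cs.exists_isReduced w
  have h' : cs.IsReduced (ω ++ [i]) := by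
    rw [IsReduced, wordProd_append, wordProd_singleton, cs.not_isRightDescent_iff.mp h, hω.eq]
    simp
  rw [cs.zeroHecke_wordProd hω, ← wordProd_singleton, ← wordProd_append,
    cs.zeroHecke_wordProd h']
  simp

theorem zeroHecke_mul_gen_of_isRightDescent {w : W} {i : B} (h : cs.IsRightDescent w i) :
    cs.zeroHecke w * gen M i = cs.zeroHecke w := by
  have h' := cs.zeroHecke_mul_gen_of_not_isRightDescent
    (cs.isRightDescent_iff_not_isRightDescent_mul.mp h)
  rw [simple_mul_simple_cancel_right] at h'
  rw [← h', mul_assoc, gen_mul_gen]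

theorem zeroHecke_surjective : Function.Surjective cs.zeroHecke := by
  intro h
  have hh : h ∈ Submonoid.closure (Set.range (gen M)) := by simp [closure_range_gen]
  induction hh using Submonoid.closure_induction_left with
  | one => exact ⟨1, cs.zeroHecke_one⟩
  | mul_left x hx y hy ih =>
    obtain ⟨i, rfl⟩ := hx
    obtain ⟨w, rfl⟩ := ih
    by_cases hd : cs.IsLeftDescent w i
    · exact ⟨w, (cs.gen_mul_zeroHecke_of_isLeftDescent hd).symm⟩
    · exact ⟨_, (cs.gen_mul_zeroHecke_of_not_isLeftDescent hd).symm⟩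

open Pointwise

/-- The products of subwords of an alternating word are the products of alternating words. -/
theorem prod_map_pair_prefixAlternatingWord (i j : B) (n : ℕ) :
    ((prefixAlternatingWord i j n).map fun a => ({1, cs.simple a} : Set W)).prod =
      {x | (∃ k ≤ n, x = cs.wordProd (prefixAlternatingWord i j k)) ∨
        ∃ k < n, x = cs.wordProd (prefixAlternatingWord j i k)} := by
  induction n generalizing i j with
  | zero => ext x; simp [prefixAlternatingWord]
  | succ n ih =>
    rw [prefixAlternatingWord, map_cons, prod_cons, ih]
    ext x
    simp only [Set.mem_mul, Set.mem_insert_iff, Set.mem_singleton_iff, Set.mem_ofPred_eq]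
    constructor
    · rintro ⟨a, rfl | rfl, y, ⟨k, hk, rfl⟩ | ⟨k, hk, rfl⟩, rfl⟩
      · exact Or.inr ⟨k, by omega, one_mul _⟩
      · exact Or.inl ⟨k, by omega, one_mul _⟩
      · exact Or.inl ⟨k + 1, by omega, by rw [prefixAlternatingWord, wordProd_cons]⟩
      · cases k with
        | zero => exact Or.inl ⟨1, by omega, by simp [prefixAlternatingWord]⟩
        | succ k =>
          refine Or.inr ⟨k, by omega, ?_⟩
          rw [prefixAlternatingWord, wordProd_cons, simple_mul_simple_cancel_left]
    · rintro (⟨k, hk, rfl⟩ | ⟨k, hk, rfl⟩)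
      · cases k with
        | zero => exact ⟨1, Or.inl rfl, 1, Or.inl ⟨0, by omega, by simp [prefixAlternatingWord]⟩,
            by simp [prefixAlternatingWord]⟩
        | succ k => exact ⟨_, Or.inr rfl, _, Or.inl ⟨k, by omega, rfl⟩,
            by rw [prefixAlternatingWord, wordProd_cons]⟩
      · exact ⟨1, Or.inl rfl, _, Or.inl ⟨k, by omega, rfl⟩, one_mul _⟩

/-- The homomorphism from the `0`-Hecke monoid to the subsets of `W` that sends the generator of
`s` to `{1, s}`; the image of a product of generators consists of the products of all subwords. -/
def subwordProducts : ZeroHeckeMonoid M →* Set W :=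
  PresentedMonoid.lift (fun i => {1, cs.simple i}) <| by
    rintro _ _ (i | ⟨i, j⟩)
    · rw [map_mul, FreeMonoid.lift_eval_of]
      ext x
      simp only [Set.mem_mul, Set.mem_insert_iff, Set.mem_singleton_iff]
      constructor
      · rintro ⟨a, rfl | rfl, b, rfl | rfl, rfl⟩ <;> simp
      · rintro (rfl | rfl)
        · exact ⟨1, Or.inl rfl, 1, Or.inl rfl, one_mul 1⟩
        · exact ⟨1, Or.inl rfl, _, Or.inr rfl, one_mul _⟩
    · have hb : cs.wordProd (prefixAlternatingWord i j (M i j)) =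
          cs.wordProd (prefixAlternatingWord j i (M i j)) :=
        prod_map_prefixAlternatingWord_eq cs.simple (cs.wordProd_braidWord_eq i j)
      have key : ((prefixAlternatingWord i j (M i j)).map
            fun a => ({1, cs.simple a} : Set W)).prod =
          ((prefixAlternatingWord j i (M i j)).map fun a => ({1, cs.simple a} : Set W)).prod := by
        rw [prod_map_pair_prefixAlternatingWord, prod_map_pair_prefixAlternatingWord]
        ext x
        constructor
        · rintro (⟨k, hk, rfl⟩ | ⟨k, hk, rfl⟩)
          · obtain hk | rfl := hk.lt_or_eq
            · exact Or.inr ⟨k, hk, rfl⟩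
            · exact Or.inl ⟨_, le_rfl, hb⟩
          · exact Or.inl ⟨k, hk.le, rfl⟩
        · rintro (⟨k, hk, rfl⟩ | ⟨k, hk, rfl⟩)
          · obtain hk | rfl := hk.lt_or_eq
            · exact Or.inr ⟨k, hk, rfl⟩
            · exact Or.inl ⟨_, le_rfl, hb.symm⟩
          · exact Or.inl ⟨k, hk.le, rfl⟩
      rw [FreeMonoid.lift_ofList, FreeMonoid.lift_ofList, braidWord, braidWord, M.symmetric j i,
        alternatingWord_eq_prefixAlternatingWord, alternatingWord_eq_prefixAlternatingWord]
      split_ifs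
      · exact key
      · exact key.symm

theorem subwordProducts_gen (i : B) : cs.subwordProducts (gen M i) = {1, cs.simple i} := rfl

theorem wordProd_mem_subwordProducts (ω : List B) :
    cs.wordProd ω ∈ cs.subwordProducts (ω.map (gen M)).prod := by
  induction ω with
  | nil => simp
  | cons i ω ih =>
    rw [map_cons, prod_cons, map_mul, wordProd_cons]
    exact Set.mul_mem_mul (by simp [subwordProducts_gen]) ih

theorem eq_or_length_lt_of_mem_subwordProducts {ω : List B} {x : W}
    (hx : x ∈ cs.subwordProducts (ω.map (gen M)).prod) :
    x = cs.wordProd ω ∨ cs.length x < ω.length := by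
  induction ω generalizing x with
  | nil => simpa using hx
  | cons i ω ih =>
    rw [map_cons, prod_cons, map_mul, subwordProducts_gen] at hx
    have hle : ∀ y ∈ cs.subwordProducts (ω.map (gen M)).prod, cs.length y ≤ ω.length := by
      intro y hy
      obtain rfl | h := ih hy
      · exact cs.length_wordProd_le ω
      · exact h.le
    obtain ⟨a, rfl | rfl, y, hy, rfl⟩ := hx
    · right
      simpa using Nat.lt_succ_of_le (hle y hy)
    · obtain rfl | h := ih hy
      · exact Or.inl (cs.wordProd_cons i ω).symm
      · right
        have := cs.length_mul_le (cs.simple i) y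
        rw [length_simple] at this
        simp only [length_cons]
        omega

theorem mem_subwordProducts_zeroHecke (w : W) : w ∈ cs.subwordProducts (cs.zeroHecke w) := by
  obtain ⟨ω, hω, rfl⟩ := cs.exists_isReduced w
  rw [cs.zeroHecke_wordProd hω]
  exact cs.wordProd_mem_subwordProducts ω

/-- If `z_x` is the product of `z_u` and `z_v`, then `x` is shorter than `ℓ(u) + ℓ(v)` unless
`x = u v`. -/
theorem eq_mul_or_length_lt_of_zeroHecke_mul {u v x : W}
    (h : cs.zeroHecke u * cs.zeroHecke v = cs.zeroHecke x) :
    x = u * v ∨ cs.length x < cs.length u + cs.length v := by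
  have hx := cs.mem_subwordProducts_zeroHecke x
  obtain ⟨ω, hω, rfl⟩ := cs.exists_isReduced u
  obtain ⟨ω', hω', rfl⟩ := cs.exists_isReduced v
  rw [← h, cs.zeroHecke_wordProd hω, cs.zeroHecke_wordProd hω', ← prod_append, ← map_append] at hx
  simpa [wordProd_append, hω.eq, hω'.eq] using cs.eq_or_length_lt_of_mem_subwordProducts hx

theorem zeroHecke_injective : Function.Injective cs.zeroHecke := by
  intro u v h
  have h1 := cs.eq_mul_or_length_lt_of_zeroHecke_mul (u := u) (v := 1) (x := v)
    (by rw [zeroHecke_one, mul_one, h])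
  have h2 := cs.eq_mul_or_length_lt_of_zeroHecke_mul (u := v) (v := 1) (x := u)
    (by rw [zeroHecke_one, mul_one, h])
  simp only [mul_one, length_one, add_zero] at h1 h2
  obtain h1 | h1 := h1
  · exact h1.symm
  · exact h2.resolve_right h1.asymm

theorem zeroHecke_mul_of_length_add {u v : W}
    (h : cs.length (u * v) = cs.length u + cs.length v) :
    cs.zeroHecke u * cs.zeroHecke v = cs.zeroHecke (u * v) := by
  obtain ⟨ω, hω, rfl⟩ := cs.exists_isReduced u
  obtain ⟨ω', hω', rfl⟩ := cs.exists_isReduced v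
  rw [← wordProd_append] at h ⊢
  rw [cs.zeroHecke_wordProd hω, cs.zeroHecke_wordProd hω', cs.zeroHecke_wordProd, map_append,
    prod_append]
  rw [IsReduced, h, hω.eq, hω'.eq, length_append]

/-! ### Parabolic subgroups -/

theorem exists_isReduced_of_mem_parabolic {J : Set B} {w : W} (hw : w ∈ cs.parabolic J) :
    ∃ ω : List B, cs.IsReduced ω ∧ cs.wordProd ω = w ∧ ∀ i ∈ ω, i ∈ J := by
  have step : ∀ i ∈ J, ∀ w : W,
      (∃ ω : List B, cs.IsReduced ω ∧ cs.wordProd ω = w ∧ ∀ i ∈ ω, i ∈ J) →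
      ∃ ω : List B, cs.IsReduced ω ∧ cs.wordProd ω = cs.simple i * w ∧ ∀ i ∈ ω, i ∈ J := by
    rintro i hi _ ⟨ω, hω, rfl, hJ⟩
    by_cases hd : cs.IsLeftDescent (cs.wordProd ω) i
    · obtain ⟨k, hk, hk'⟩ := cs.exists_simple_mul_wordProd_eq_eraseIdx hd
      refine ⟨ω.eraseIdx k, ?_, hk'.symm, fun a ha => hJ a (mem_of_mem_eraseIdx ha)⟩
      have h1 := length_eraseIdx_add_one hk
      have h2 := cs.isLeftDescent_iff.mp hd
      rw [hk', hω.eq] at h2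
      rw [IsReduced]
      omega
    · refine ⟨i :: ω, ?_, cs.wordProd_cons i ω, by simpa using ⟨hi, hJ⟩⟩
      rw [IsReduced, wordProd_cons, cs.not_isLeftDescent_iff.mp hd, hω.eq, length_cons]
  induction hw using Subgroup.closure_induction_left with
  | one => exact ⟨[], by simp [IsReduced], by simp, by simp⟩
  | mul_left x hx y _ ih =>
    obtain ⟨i, hi, rfl⟩ := hx
    exact step i hi y ih
  | inv_mul_cancel x hx y _ ih =>
    obtain ⟨i, hi, rfl⟩ := hx
    rw [inv_simple]
    exact step i hi y ih

theorem simple_mem_parabolic {J : Set B} {i : B} (hi : i ∈ J) : cs.simple i ∈ cs.parabolic J :=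
  Subgroup.subset_closure ⟨i, hi, rfl⟩

theorem simple_mem_parabolic_iff {J : Set B} {i : B} : cs.simple i ∈ cs.parabolic J ↔ i ∈ J := by
  refine ⟨fun h => ?_, cs.simple_mem_parabolic⟩
  obtain ⟨ω, hω, hi, hJ⟩ := cs.exists_isReduced_of_mem_parabolic h
  have hlen := hω.eq
  rw [hi, length_simple] at hlen
  obtain ⟨j, rfl⟩ := List.length_eq_one_iff.mp hlen.symm
  rw [wordProd_singleton] at hi
  rw [← cs.simple_injective hi]
  exact hJ j (by simp)

theorem wordProd_mem_parabolic {J : Set B} {ω : List B} (h : ∀ i ∈ ω, i ∈ J) :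
    cs.wordProd ω ∈ cs.parabolic J := by
  refine Subgroup.list_prod_mem _ fun x hx => ?_
  obtain ⟨i, hi, rfl⟩ := mem_map.mp hx
  exact cs.simple_mem_parabolic (h i hi)

theorem parabolic_univ : cs.parabolic Set.univ = ⊤ := by
  rw [parabolic, Set.image_univ, subgroup_closure_range_simple]

/-- The maximal parabolic subgroups intersect trivially. -/
theorem eq_one_of_forall_mem_parabolic_compl {w : W} (h : ∀ i : B, w ∈ cs.parabolic {i}ᶜ) :
    w = 1 := by
  by_contra hw
  obtain ⟨i, hi⟩ := cs.exists_leftDescent_of_ne_one hw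
  obtain ⟨ω, hω, rfl, hJ⟩ := cs.exists_isReduced_of_mem_parabolic (h i)
  obtain ⟨k, hk, hk'⟩ := cs.exists_simple_mul_wordProd_eq_eraseIdx hi
  have h1 : cs.simple i * cs.wordProd ω ∈ cs.parabolic {i}ᶜ := by
    rw [hk']
    exact cs.wordProd_mem_parabolic fun a ha => hJ a (mem_of_mem_eraseIdx ha)
  have h2 := (Subgroup.mul_mem_cancel_right _ (h i)).mp h1
  simpa using cs.simple_mem_parabolic_iff.mp h2

theorem exists_zeroHecke_mul_eq_of_mem_closure {J : Set B} {h : ZeroHeckeMonoid M}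
    (hh : h ∈ Submonoid.closure (gen M '' J)) (u : W) :
    ∃ w ∈ cs.parabolic J, cs.zeroHecke u * h = cs.zeroHecke (u * w) := by
  induction hh using Submonoid.closure_induction generalizing u with
  | mem x hx =>
    obtain ⟨i, hi, rfl⟩ := hx
    by_cases hd : cs.IsRightDescent u i
    · exact ⟨1, one_mem _, by rw [cs.zeroHecke_mul_gen_of_isRightDescent hd, mul_one]⟩
    · exact ⟨_, cs.simple_mem_parabolic hi, cs.zeroHecke_mul_gen_of_not_isRightDescent hd⟩
  | one => exact ⟨1, one_mem _, by simp⟩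
  | mul x y _ _ hx hy =>
    obtain ⟨v, hv, hv'⟩ := hx u
    obtain ⟨w, hw, hw'⟩ := hy (u * v)
    exact ⟨v * w, mul_mem hv hw, by rw [← mul_assoc, hv', hw', mul_assoc]⟩

/-! ### Longest elements -/

variable [Finite W]

theorem longest_mem (J : Set B) : cs.longest J ∈ cs.parabolic J :=
  (cs.exists_longest J).choose_spec.1

theorem length_le_longest {J : Set B} {v : W} (hv : v ∈ cs.parabolic J) :
    cs.length v ≤ cs.length (cs.longest J) :=
  (cs.exists_longest J).choose_spec.2 v hv

theorem length_le_longest_univ (v : W) : cs.length v ≤ cs.length (cs.longest Set.univ) :=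
  cs.length_le_longest (by simp [parabolic_univ])

theorem isLeftDescent_longest {J : Set B} {i : B} (hi : i ∈ J) :
    cs.IsLeftDescent (cs.longest J) i :=
  (cs.length_le_longest (mul_mem (cs.simple_mem_parabolic hi) (cs.longest_mem J))).lt_of_ne
    (cs.length_simple_mul_ne _ _)

theorem isRightDescent_longest {J : Set B} {i : B} (hi : i ∈ J) :
    cs.IsRightDescent (cs.longest J) i :=
  (cs.length_le_longest (mul_mem (cs.longest_mem J) (cs.simple_mem_parabolic hi))).lt_of_ne
    (cs.length_mul_simple_ne _ _)

theorem gen_mul_idem {J : Set B} {i : B} (hi : i ∈ J) : gen M i * cs.idem J = cs.idem J :=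
  cs.gen_mul_zeroHecke_of_isLeftDescent (cs.isLeftDescent_longest hi)

theorem idem_mul_gen {J : Set B} {i : B} (hi : i ∈ J) : cs.idem J * gen M i = cs.idem J :=
  cs.zeroHecke_mul_gen_of_isRightDescent (cs.isRightDescent_longest hi)

theorem idem_mem_closure (J : Set B) : cs.idem J ∈ Submonoid.closure (gen M '' J) := by
  obtain ⟨ω, hω, hw, hJ⟩ := cs.exists_isReduced_of_mem_parabolic (cs.longest_mem J)
  rw [idem, ← hw, cs.zeroHecke_wordProd hω]
  refine Submonoid.list_prod_mem _ fun x hx => ?_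
  obtain ⟨i, hi, rfl⟩ := mem_map.mp hx
  exact Submonoid.subset_closure ⟨i, hJ i hi, rfl⟩

theorem mul_idem_of_mem_closure {J : Set B} {h : ZeroHeckeMonoid M}
    (hh : h ∈ Submonoid.closure (gen M '' J)) : h * cs.idem J = cs.idem J := by
  induction hh using Submonoid.closure_induction_left with
  | one => exact one_mul _
  | mul_left x hx y _ ih =>
    obtain ⟨i, hi, rfl⟩ := hx
    rw [mul_assoc, ih, cs.gen_mul_idem hi]

theorem idem_mul_of_mem_closure {J : Set B} {h : ZeroHeckeMonoid M}
    (hh : h ∈ Submonoid.closure (gen M '' J)) : cs.idem J * h = cs.idem J := by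
  induction hh using Submonoid.closure_induction_left with
  | one => exact mul_one _
  | mul_left x hx y _ ih =>
    obtain ⟨i, hi, rfl⟩ := hx
    rw [← mul_assoc, cs.idem_mul_gen hi, ih]

theorem idem_mul_idem (J : Set B) : cs.idem J * cs.idem J = cs.idem J :=
  cs.mul_idem_of_mem_closure (cs.idem_mem_closure J)

theorem mul_idem_univ (h : ZeroHeckeMonoid M) :
    h * cs.idem Set.univ = cs.idem Set.univ :=
  cs.mul_idem_of_mem_closure (by simp [closure_range_gen])

theorem idem_univ_mul (h : ZeroHeckeMonoid M) :
    cs.idem Set.univ * h = cs.idem Set.univ :=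
  cs.idem_mul_of_mem_closure (by simp [closure_range_gen])

theorem eq_longest_of_forall_isLeftDescent {w : W} (h : ∀ i, cs.IsLeftDescent w i) :
    w = cs.longest Set.univ := by
  have key : ∀ x ∈ Submonoid.closure (Set.range (gen M)), x * cs.zeroHecke w = cs.zeroHecke w := by
    intro x hx
    induction hx using Submonoid.closure_induction_left with
    | one => exact one_mul _
    | mul_left x hx y _ ih =>
      obtain ⟨i, rfl⟩ := hx
      rw [mul_assoc, ih, cs.gen_mul_zeroHecke_of_isLeftDescent (h i)]
  apply cs.zeroHecke_injective
  rw [← key (cs.idem Set.univ) (by simp [closure_range_gen]), idem_univ_mul, idem]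

theorem length_longest_mul_inv_add (w : W) :
    cs.length (cs.longest Set.univ * w⁻¹) + cs.length w = cs.length (cs.longest Set.univ) := by
  obtain ⟨n, hn⟩ : ∃ n, cs.length (cs.longest Set.univ) - cs.length w = n := ⟨_, rfl⟩
  induction n generalizing w with
  | zero =>
    by_cases h : ∀ i, cs.IsLeftDescent w i
    · obtain rfl := cs.eq_longest_of_forall_isLeftDescent h
      simp
    · push Not at h
      obtain ⟨i, hi⟩ := h
      have h1 := cs.not_isLeftDescent_iff.mp hi
      have h2 := cs.length_le_longest_univ (cs.simple i * w)
      omega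
  | succ n ih =>
    by_cases h : ∀ i, cs.IsLeftDescent w i
    · obtain rfl := cs.eq_longest_of_forall_isLeftDescent h
      simp
    · push Not at h
      obtain ⟨i, hi⟩ := h
      have h1 := cs.not_isLeftDescent_iff.mp hi
      have h2 := ih (cs.simple i * w) (by omega)
      have h3 := cs.length_mul_le (cs.longest Set.univ * (cs.simple i * w)⁻¹) (cs.simple i)
      have h4 := cs.length_mul_le (cs.longest Set.univ * w⁻¹) w
      rw [mul_inv_rev, inv_simple, mul_assoc, mul_assoc, simple_mul_simple_self, mul_one,
        length_simple] at h3
      rw [inv_mul_cancel_right] at h4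
      rw [mul_inv_rev, inv_simple] at h2
      omega

theorem zeroHecke_longest_mul_inv_mul (w : W) :
    cs.zeroHecke (cs.longest Set.univ * w⁻¹) * cs.zeroHecke w = cs.idem Set.univ := by
  rw [zeroHecke_mul_of_length_add, inv_mul_cancel_right, idem]
  rw [inv_mul_cancel_right, length_longest_mul_inv_add]

theorem exists_simple_eq_conj_longest (i : B) :
    ∃ j, cs.simple j = cs.longest Set.univ * cs.simple i * (cs.longest Set.univ)⁻¹ := by
  have h1 := cs.length_longest_mul_inv_add (cs.longest Set.univ * cs.simple i)
  have h2 := cs.isRightDescent_iff.mp (cs.isRightDescent_longest (Set.mem_univ i))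
  have h3 : cs.length (cs.longest Set.univ * cs.simple i * (cs.longest Set.univ)⁻¹) = 1 := by
    rw [mul_inv_rev, inv_simple, ← mul_assoc] at h1
    omega
  obtain ⟨j, hj⟩ := cs.length_eq_one_iff.mp h3
  exact ⟨j, hj.symm⟩

/-- The involution `s ↦ w₀ s w₀` of the simple generators (the opposition involution), as a map
on their index type. -/
noncomputable def opposite (i : B) : B := (cs.exists_simple_eq_conj_longest i).choose

theorem simple_opposite (i : B) : cs.simple (cs.opposite i) =
    cs.longest Set.univ * cs.simple i * (cs.longest Set.univ)⁻¹ :=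
  (cs.exists_simple_eq_conj_longest i).choose_spec

theorem simple_opposite_mul_longest (i : B) :
    cs.simple (cs.opposite i) * cs.longest Set.univ = cs.longest Set.univ * cs.simple i := by
  rw [simple_opposite, inv_mul_cancel_right]

theorem opposite_injective : Function.Injective cs.opposite := by
  intro i j h
  have := congrArg cs.simple h
  rw [simple_opposite, simple_opposite] at this
  exact cs.simple_injective (mul_left_cancel (mul_right_cancel this))

/-! ### Cosets of parabolic subgroups -/

theorem zeroHecke_mul_simple_mul_idem {J : Set B} {i : B} (hi : i ∈ J) (u : W) :
    cs.zeroHecke (u * cs.simple i) * cs.idem J = cs.zeroHecke u * cs.idem J := by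
  by_cases hd : cs.IsRightDescent u i
  · have h := cs.zeroHecke_mul_gen_of_not_isRightDescent
      (cs.isRightDescent_iff_not_isRightDescent_mul.mp hd)
    rw [simple_mul_simple_cancel_right] at h
    rw [← h, mul_assoc, cs.gen_mul_idem hi]
  · rw [← cs.zeroHecke_mul_gen_of_not_isRightDescent hd, mul_assoc, cs.gen_mul_idem hi]

/-- The elements of `H(W) e_J` correspond to the left cosets of `W_J`. -/
theorem zeroHecke_mul_idem_eq_iff {J : Set B} {u v : W} :
    cs.zeroHecke u * cs.idem J = cs.zeroHecke v * cs.idem J ↔ u⁻¹ * v ∈ cs.parabolic J := by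
  constructor
  · intro h
    obtain ⟨a, ha, ha'⟩ := cs.exists_zeroHecke_mul_eq_of_mem_closure (cs.idem_mem_closure J) u
    obtain ⟨b, hb, hb'⟩ := cs.exists_zeroHecke_mul_eq_of_mem_closure (cs.idem_mem_closure J) v
    rw [ha', hb'] at h
    have h1 : u⁻¹ * v = a * b⁻¹ := by
      rw [inv_mul_eq_iff_eq_mul, ← mul_assoc, cs.zeroHecke_injective h, mul_inv_cancel_right]
    rw [h1]
    exact mul_mem ha (inv_mem hb)
  · intro h
    have key : ∀ w ∈ cs.parabolic J,
        cs.zeroHecke (u * w) * cs.idem J = cs.zeroHecke u * cs.idem J := by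
      intro w hw
      induction hw using Subgroup.closure_induction_right with
      | one => rw [mul_one]
      | mul_right x _ y hy ih =>
        obtain ⟨i, hi, rfl⟩ := hy
        rw [← mul_assoc, cs.zeroHecke_mul_simple_mul_idem hi, ih]
      | mul_inv_cancel x _ y hy ih =>
        obtain ⟨i, hi, rfl⟩ := hy
        rw [inv_simple, ← mul_assoc, cs.zeroHecke_mul_simple_mul_idem hi, ih]
    rw [← key _ h, mul_inv_cancel_left]

end CoxeterSystem

/-! ### The monoid algebra as a Frobenius algebra -/

namespace CoxeterSystem

open ZeroHeckeMonoid

variable {B W : Type*} [Group W] {M : CoxeterMatrix B} (cs : CoxeterSystem M W)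

theorem length_simple_mul_simple {i j : B} (hij : i ≠ j) :
    cs.length (cs.simple i * cs.simple j) = 2 := by
  have h := cs.length_mul_simple (cs.simple i) j
  rw [length_simple] at h
  obtain h | h := h
  · exact h
  · have h0 : cs.length (cs.simple i * cs.simple j) = 0 := by omega
    rw [length_eq_zero_iff, mul_eq_one_iff_eq_inv, inv_simple] at h0
    exact absurd (cs.simple_injective h0) hij

variable [Finite W]

theorem zeroHecke_mul_gen_eq_idem_univ_iff {w : W} {i : B} :
    cs.zeroHecke w * gen M i = cs.idem Set.univ ↔
      w = cs.longest Set.univ ∨ w = cs.longest Set.univ * cs.simple i := by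
  constructor
  · intro h
    by_cases hd : cs.IsRightDescent w i
    · rw [cs.zeroHecke_mul_gen_of_isRightDescent hd] at h
      exact Or.inl (cs.zeroHecke_injective h)
    · rw [cs.zeroHecke_mul_gen_of_not_isRightDescent hd] at h
      right
      rw [← cs.zeroHecke_injective h, simple_mul_simple_cancel_right]
  · rintro (rfl | rfl)
    · exact cs.idem_mul_gen (Set.mem_univ i)
    · rw [cs.zeroHecke_mul_gen_of_not_isRightDescent
        (cs.isRightDescent_iff_not_isRightDescent_mul.mp
          (cs.isRightDescent_longest (Set.mem_univ i))), simple_mul_simple_cancel_right]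
      rfl

theorem gen_mul_zeroHecke_eq_idem_univ_iff {w : W} {i : B} :
    gen M i * cs.zeroHecke w = cs.idem Set.univ ↔
      w = cs.longest Set.univ ∨ w = cs.simple i * cs.longest Set.univ := by
  constructor
  · intro h
    by_cases hd : cs.IsLeftDescent w i
    · rw [cs.gen_mul_zeroHecke_of_isLeftDescent hd] at h
      exact Or.inl (cs.zeroHecke_injective h)
    · rw [cs.gen_mul_zeroHecke_of_not_isLeftDescent hd] at h
      right
      rw [← cs.zeroHecke_injective h, simple_mul_simple_cancel_left]
  · rintro (rfl | rfl)
    · exact cs.gen_mul_idem (Set.mem_univ i)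
    · rw [cs.gen_mul_zeroHecke_of_not_isLeftDescent
        (cs.isLeftDescent_iff_not_isLeftDescent_mul.mp
          (cs.isLeftDescent_longest (Set.mem_univ i))), simple_mul_simple_cancel_left]
      rfl

section Field

variable (k : Type*) [Field k]

local notation "A" => MonoidAlgebra k (ZeroHeckeMonoid M)
local notation "toA" => MonoidAlgebra.of k (ZeroHeckeMonoid M)

/-- The coefficient of the zero element `e_0` of the `0`-Hecke monoid. This linear functional is a
Frobenius form on the monoid algebra. -/
noncomputable def topCoeff : A →ₗ[k] k where
  toFun x := x.coeff (cs.idem Set.univ)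
  map_add' x y := by simp
  map_smul' c x := by simp

variable {k}

open Classical in
theorem topCoeff_single (h : ZeroHeckeMonoid M) (r : k) :
    cs.topCoeff k (MonoidAlgebra.single h r) = if h = cs.idem Set.univ then r else 0 := by
  change (MonoidAlgebra.single h r).coeff (cs.idem Set.univ) = _
  rw [MonoidAlgebra.coeff_single, Finsupp.single_apply]

open Classical in
theorem topCoeff_of_mul (g : ZeroHeckeMonoid M) (x : A) :
    cs.topCoeff k (toA g * x) =
      x.coeff.sum fun h r => if g * h = cs.idem Set.univ then r else 0 := by
  induction x using MonoidAlgebra.induction_linear with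
  | zero => simp
  | add x y hx hy =>
    rw [mul_add, map_add, hx, hy, MonoidAlgebra.coeff_add, Finsupp.sum_add_index']
    · simp
    · intro h r r'
      split_ifs <;> simp
  | single h r =>
    rw [MonoidAlgebra.of_apply, MonoidAlgebra.single_mul_single, topCoeff_single,
      MonoidAlgebra.coeff_single, Finsupp.sum_single_index (by simp), one_mul]

/-- Nondegeneracy of the Frobenius form. If `w` is a longest element of the support of `x`, then
left multiplication by `z_b` with `b = w₀ w⁻¹` moves `w`, and no other element of the support, to
the longest element `w₀`. -/
theorem exists_topCoeff_of_mul_ne_zero {x : A} (hx : x ≠ 0) :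
    ∃ g, cs.topCoeff k (toA g * x) ≠ 0 := by
  classical
  have hne : x.coeff.support.Nonempty :=
    Finsupp.support_nonempty_iff.mpr (by simpa using hx)
  let e := Equiv.ofBijective cs.zeroHecke ⟨cs.zeroHecke_injective, cs.zeroHecke_surjective⟩
  obtain ⟨h, hh, hmax⟩ := x.coeff.support.exists_max_image (fun h => cs.length (e.symm h)) hne
  obtain ⟨w, rfl⟩ := e.surjective h
  refine ⟨cs.zeroHecke (cs.longest Set.univ * w⁻¹), ?_⟩
  rw [topCoeff_of_mul, Finsupp.sum, Finset.sum_eq_single (e w)]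
  · have hw : cs.zeroHecke (cs.longest Set.univ * w⁻¹) * e w = cs.idem Set.univ :=
      cs.zeroHecke_longest_mul_inv_mul w
    rw [if_pos hw]
    exact Finsupp.mem_support_iff.mp hh
  · intro h' hh' hne'
    obtain ⟨v, rfl⟩ := e.surjective h'
    refine if_neg fun heq => ?_
    have hle := hmax _ hh'
    simp only [Equiv.symm_apply_apply] at hle
    have hlen := cs.length_longest_mul_inv_add w
    obtain h1 | h1 := cs.eq_mul_or_length_lt_of_zeroHecke_mul heq
    · rw [mul_assoc, left_eq_mul, inv_mul_eq_one] at h1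
      exact hne' (by rw [h1])
    · omega
  · intro h'
    exact absurd hh h'

/-- The Nakayama automorphism of the Frobenius form is induced by the opposition involution. -/
theorem topCoeff_mul_of_gen (x : A) (i : B) :
    cs.topCoeff k (x * toA (gen M i)) = cs.topCoeff k (toA (gen M (cs.opposite i)) * x) := by
  classical
  induction x using MonoidAlgebra.induction_linear with
  | zero => simp
  | add x y hx hy => rw [mul_add, add_mul, map_add, map_add, hx, hy]
  | single h r =>
    obtain ⟨w, rfl⟩ := cs.zeroHecke_surjective h
    rw [MonoidAlgebra.of_apply, MonoidAlgebra.of_apply, MonoidAlgebra.single_mul_single,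
      MonoidAlgebra.single_mul_single, topCoeff_single, topCoeff_single,
      zeroHecke_mul_gen_eq_idem_univ_iff, gen_mul_zeroHecke_eq_idem_univ_iff,
      simple_opposite_mul_longest, one_mul, mul_one]

/-! ### Common eigenvectors of the generators -/

/-- A common eigenvector of the generators is a common eigenvector of all elements of the monoid. -/
theorem of_smul_eq_or_eq_zero {V : Type*} [AddCommGroup V] [Module A V] {v : V}
    (hv : ∀ i, toA (gen M i) • v = v ∨ toA (gen M i) • v = 0) (h : ZeroHeckeMonoid M) :
    toA h • v = v ∨ toA h • v = 0 := by
  have hh : h ∈ Submonoid.closure (Set.range (gen M)) := by simp [closure_range_gen]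
  induction hh using Submonoid.closure_induction_left with
  | one => left; rw [map_one, one_smul]
  | mul_left x hx y _ ih =>
    obtain ⟨i, rfl⟩ := hx
    rw [map_mul, mul_smul]
    obtain ih | ih := ih
    · rw [ih]; exact hv i
    · rw [ih, smul_zero]; exact Or.inr rfl

theorem of_smul_eq_of_forall_gen {V : Type*} [AddCommGroup V] [Module A V] {v : V}
    (hv : ∀ i, toA (gen M i) • v = v) (h : ZeroHeckeMonoid M) : toA h • v = v := by
  have hh : h ∈ Submonoid.closure (Set.range (gen M)) := by simp [closure_range_gen]
  induction hh using Submonoid.closure_induction_left with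
  | one => rw [map_one, one_smul]
  | mul_left x hx y _ ih =>
    obtain ⟨i, rfl⟩ := hx
    rw [map_mul, mul_smul, ih, hv]

/-- Every nonzero vector has a nonzero multiple on which each generator acts by `0` or `1`: apply
`z_w` for a longest `w` that does not annihilate the vector. -/
theorem exists_smul_eigenvector {V : Type*} [AddCommGroup V] [Module A V] {v : V} (hv : v ≠ 0) :
    ∃ w : W, toA (cs.zeroHecke w) • v ≠ 0 ∧
      ∀ i, toA (gen M i) • toA (cs.zeroHecke w) • v = toA (cs.zeroHecke w) • v ∨
        toA (gen M i) • toA (cs.zeroHecke w) • v = 0 := by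
  obtain ⟨w, hw, hmax⟩ := Set.exists_max_image {w : W | toA (cs.zeroHecke w) • v ≠ 0} cs.length
    (Set.toFinite _) ⟨1, by simpa only [Set.mem_ofPred_eq, zeroHecke_one, map_one, one_smul] using hv⟩
  refine ⟨w, hw, fun i => ?_⟩
  rw [smul_smul, ← map_mul]
  by_cases hd : cs.IsLeftDescent w i
  · rw [cs.gen_mul_zeroHecke_of_isLeftDescent hd]
    exact Or.inl rfl
  · right
    rw [cs.gen_mul_zeroHecke_of_not_isLeftDescent hd]
    by_contra h
    have h1 := hmax _ h
    have h2 := cs.not_isLeftDescent_iff.mp hd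
    omega

theorem topCoeff_ne_zero_of_eigenvector {x : A} (hx : x ≠ 0)
    (h : ∀ i, toA (gen M i) * x = x ∨ toA (gen M i) * x = 0) : cs.topCoeff k x ≠ 0 := by
  obtain ⟨g, hg⟩ := cs.exists_topCoeff_of_mul_ne_zero hx
  obtain h1 | h1 := of_smul_eq_or_eq_zero (k := k) (M := M) (V := A) (v := x) h g
  · rw [smul_eq_mul] at h1
    rwa [h1] at hg
  · rw [smul_eq_mul] at h1
    rw [h1, map_zero] at hg
    exact absurd rfl hg

/-! ### The ideals generated by `e_{(s)} - e_0` and their socles -/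

theorem mem_projIdeal {i : B} {x : A} : x ∈ cs.projIdeal k i ↔
    ∃ a, a * (toA (cs.idem {i}ᶜ) - toA (cs.idem Set.univ)) = x := by
  rw [projIdeal, Submodule.mem_span_singleton]
  rfl

theorem mul_of_gen_of_mem_projIdeal {i j : B} (hij : j ≠ i) {x : A}
    (hx : x ∈ cs.projIdeal k i) : x * toA (gen M j) = x := by
  obtain ⟨a, rfl⟩ := cs.mem_projIdeal.mp hx
  rw [mul_assoc, sub_mul, ← map_mul, ← map_mul, cs.idem_mul_gen (by simpa using hij),
    cs.idem_univ_mul]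

theorem of_idem_univ_mul_of_mem_projIdeal {i : B} {x : A} (hx : x ∈ cs.projIdeal k i) :
    toA (cs.idem Set.univ) * x = 0 := by
  obtain ⟨a, rfl⟩ := cs.mem_projIdeal.mp hx
  induction a using MonoidAlgebra.induction_linear with
  | zero => simp
  | add a b ha hb =>
    rw [add_mul, mul_add, ha (cs.mem_projIdeal.mpr ⟨a, rfl⟩), hb (cs.mem_projIdeal.mpr ⟨b, rfl⟩),
      add_zero]
  | single h r => simp [mul_sub, MonoidAlgebra.single_mul_single, idem_univ_mul]

variable (k) in
/-- The generator `z_{w₀ s} - e_0` of the socle of `k H(W) (e_{(s)} - e_0)`. -/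
noncomputable def socleGenerator (i : B) : A :=
  toA (cs.zeroHecke (cs.longest Set.univ * cs.simple i)) - toA (cs.idem Set.univ)

theorem longest_mul_simple_ne (i : B) :
    cs.longest Set.univ * cs.simple i ≠ cs.longest Set.univ := fun h =>
  cs.length_mul_simple_ne _ i (congrArg cs.length h)

theorem topCoeff_socleGenerator (i : B) : cs.topCoeff k (cs.socleGenerator k i) = -1 := by
  have h : cs.zeroHecke (cs.longest Set.univ * cs.simple i) ≠ cs.idem Set.univ := fun h =>
    cs.longest_mul_simple_ne i (cs.zeroHecke_injective h)
  rw [socleGenerator, map_sub, MonoidAlgebra.of_apply, MonoidAlgebra.of_apply, topCoeff_single,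
    topCoeff_single, if_neg h, if_pos rfl, zero_sub]

theorem of_gen_opposite_mul_socleGenerator_self (i : B) :
    toA (gen M (cs.opposite i)) * cs.socleGenerator k i = 0 := by
  rw [socleGenerator, mul_sub, ← map_mul, ← map_mul, mul_idem_univ,
    cs.gen_mul_zeroHecke_eq_idem_univ_iff.mpr (Or.inr (cs.simple_opposite_mul_longest i).symm),
    sub_self]

theorem of_gen_opposite_mul_socleGenerator_of_ne {i j : B} (hij : j ≠ i) :
    toA (gen M (cs.opposite j)) * cs.socleGenerator k i = cs.socleGenerator k i := by
  rw [socleGenerator, mul_sub, ← map_mul, ← map_mul, mul_idem_univ,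
    cs.gen_mul_zeroHecke_of_isLeftDescent]
  have h1 := cs.length_longest_mul_inv_add (cs.simple i * cs.simple j)
  have h2 := cs.isRightDescent_iff.mp (cs.isRightDescent_longest (Set.mem_univ i))
  rw [cs.length_simple_mul_simple hij.symm, mul_inv_rev, inv_simple, inv_simple, ← mul_assoc] at h1
  rw [IsLeftDescent, ← mul_assoc, simple_opposite_mul_longest]
  omega

/-- A common eigenvector of the generators in `k H(W) (e_{(s)} - e_0)` is a multiple of
`z_{w₀ s} - e_0`, which thus spans the socle. By the Nakayama automorphism, the right action on the
ideal determines the eigenvalues of an eigenvector, and by nondegeneracy of the Frobenius form the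
eigenvalues determine the line. -/
theorem eq_smul_socleGenerator [Finite B] {i : B} {y : A} (hy : y ∈ cs.projIdeal k i) (hy0 : y ≠ 0)
    (h : ∀ j, toA (gen M j) * y = y ∨ toA (gen M j) * y = 0) :
    ∃ c : k, c ≠ 0 ∧ y = c • cs.socleGenerator k i := by
  have hc := cs.topCoeff_ne_zero_of_eigenvector hy0 h
  have hsurj : Function.Surjective cs.opposite :=
    Finite.surjective_of_injective cs.opposite_injective
  have h1 : ∀ j, j ≠ i → toA (gen M (cs.opposite j)) * y = y := by
    intro j hj
    refine (h _).resolve_right fun h0 => hc ?_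
    rw [← cs.mul_of_gen_of_mem_projIdeal hj hy, topCoeff_mul_of_gen, h0, map_zero]
  have h2 : toA (gen M (cs.opposite i)) * y = 0 := by
    refine (h _).resolve_left fun h0 => hy0 ?_
    rw [← cs.of_idem_univ_mul_of_mem_projIdeal hy]
    refine (of_smul_eq_of_forall_gen (k := k) (M := M) (V := A) (v := y) (fun j => ?_) _).symm
    obtain ⟨j, rfl⟩ := hsurj j
    by_cases hj : j = i
    · rw [hj]; exact h0
    · exact h1 j hj
  -- This combination has the same eigenvalues, and its top coefficient vanishes.
  have h3 : y + cs.topCoeff k y • cs.socleGenerator k i = 0 := by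
    by_contra hne
    refine cs.topCoeff_ne_zero_of_eigenvector hne (fun j => ?_) ?_
    · obtain ⟨j, rfl⟩ := hsurj j
      by_cases hj : j = i
      · right
        rw [hj, mul_add, mul_smul_comm, h2, of_gen_opposite_mul_socleGenerator_self, smul_zero,
          add_zero]
      · left
        rw [mul_add, mul_smul_comm, h1 j hj, cs.of_gen_opposite_mul_socleGenerator_of_ne hj]
    · rw [map_add, map_smul, topCoeff_socleGenerator]
      simp
  exact ⟨-cs.topCoeff k y, neg_ne_zero.mpr hc, by rw [neg_smul]; exact eq_neg_of_add_eq_zero_left h3⟩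

end Field

end CoxeterSystem

/-! ### Embedding the direct sum into effective modules -/

namespace CoxeterSystem

open ZeroHeckeMonoid

variable {B W : Type*} [Group W] [Finite W] {M : CoxeterMatrix B} (cs : CoxeterSystem M W)
  (k : Type*) [Field k]

local notation "A" => MonoidAlgebra k (ZeroHeckeMonoid M)
local notation "toA" => MonoidAlgebra.of k (ZeroHeckeMonoid M)

theorem projIdeal_projective (i : B) : Module.Projective A (cs.projIdeal k i) := by
  set d : A := toA (cs.idem {i}ᶜ) - toA (cs.idem Set.univ)
  have hd : d * d = d := by
    simp only [d, mul_sub, sub_mul, ← map_mul, idem_mul_idem, idem_univ_mul, mul_idem_univ,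
      sub_self, sub_zero]
  refine Module.Projective.of_split (cs.projIdeal k i).subtype
    ((LinearMap.toSpanSingleton A A d).codRestrict (cs.projIdeal k i)
      fun a => cs.mem_projIdeal.mpr ⟨a, rfl⟩) ?_
  ext ⟨x, hx⟩ : 2
  obtain ⟨a, rfl⟩ := cs.mem_projIdeal.mp hx
  change a * d * d = a * d
  rw [mul_assoc, hd]

variable {k}

/-- Vectors that the socle generators do not annihilate define an embedding of the direct sum: a
nonzero kernel would contain a common eigenvector of the generators, which lies in a single summand
since the socles of the summands belong to different eigenvalues. -/
theorem exists_injective_directSum [Finite B] {V : Type*} [AddCommGroup V] [Module A V]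
    (hV : ∀ i : B, ∃ v : V, cs.socleGenerator k i • v ≠ 0) :
    ∃ Φ : (DirectSum B fun i => cs.projIdeal k i) →ₗ[A] V, Function.Injective Φ := by
  classical
  choose m hm using hV
  let Φ : (DirectSum B fun i => cs.projIdeal k i) →ₗ[A] V :=
    DirectSum.toModule A B V fun i =>
      (LinearMap.toSpanSingleton A V (m i)).comp (cs.projIdeal k i).subtype
  -- The group structure is taken over the additive monoid that occurs in the type of `Φ`.
  let _ : AddCommGroup (DirectSum B fun i => cs.projIdeal k i) :=
    Module.addCommMonoidToAddCommGroup A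
  refine ⟨Φ, LinearMap.ker_eq_bot.mp ((Submodule.eq_bot_iff _).mpr fun x hx => ?_)⟩
  rw [LinearMap.mem_ker] at hx
  by_contra hx0
  obtain ⟨w, hw, heig⟩ := cs.exists_smul_eigenvector (k := k) hx0
  set y := toA (cs.zeroHecke w) • x with hy
  have hΦy : Φ y = 0 := by rw [hy, map_smul, hx, smul_zero]
  have hcomp : ∀ i j, (toA (gen M j) * (y i : A) = y i ∨ toA (gen M j) * (y i : A) = 0) := by
    intro i j
    have hsmul : ((toA (gen M j) • y) i : A) = toA (gen M j) * (y i : A) := rfl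
    obtain h | h := heig j
    · left; rw [← hsmul, h]
    · right; rw [← hsmul, h]; rfl
  obtain ⟨i, hi⟩ : ∃ i, (y i : A) ≠ 0 := by
    by_contra! h
    exact hw (DFinsupp.ext fun i => Subtype.ext (h i))
  obtain ⟨c, hc, hci⟩ := cs.eq_smul_socleGenerator (y i).2 hi (hcomp i)
  have hother : ∀ j, j ≠ i → y j = 0 := by
    intro j hj
    by_contra hj0
    have hj0' : (y j : A) ≠ 0 := fun h => hj0 (Subtype.ext h)
    obtain ⟨c', hc', hcj⟩ := cs.eq_smul_socleGenerator (y j).2 hj0' (hcomp j)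
    have h1 : toA (gen M (cs.opposite i)) * (y j : A) = y j := by
      rw [hcj, mul_smul_comm, cs.of_gen_opposite_mul_socleGenerator_of_ne hj.symm]
    have h2 : toA (gen M (cs.opposite i)) * (y i : A) = 0 := by
      rw [hci, mul_smul_comm, of_gen_opposite_mul_socleGenerator_self, smul_zero]
    obtain h | h := heig (cs.opposite i)
    · apply hi
      rw [← h2]
      exact (congrArg (fun z : DirectSum B fun i => cs.projIdeal k i => (z i : A)) h).symm
    · apply hj0'
      rw [← h1]
      exact congrArg (fun z : DirectSum B fun i => cs.projIdeal k i => (z j : A)) h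
  have hyi : y = DirectSum.lof A B (fun i => cs.projIdeal k i) i (y i) := by
    refine DFinsupp.ext fun j => ?_
    by_cases hj : j = i
    · subst hj
      exact (DirectSum.of_eq_same (β := fun i => cs.projIdeal k i) j (y j)).symm
    · rw [hother j hj]
      exact (DirectSum.of_eq_of_ne (β := fun i => cs.projIdeal k i) i j (y i) hj).symm
  rw [hyi, DirectSum.toModule_lof] at hΦy
  have h3 : (y i : A) • m i = 0 := hΦy
  rw [hci, Algebra.smul_def, mul_smul] at h3
  exact hm i (((isUnit_iff_ne_zero.mpr hc).map (algebraMap k A)).smul_eq_zero.mp h3)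

theorem exists_injective_directSum_of_effective [Finite B] {V : Type*} [AddCommGroup V]
    [Module k V] (ρ : Representation k (ZeroHeckeMonoid M) V) (hρ : Function.Injective ρ) :
    ∃ Φ : (DirectSum B fun i => cs.projIdeal k i) →ₗ[A] ρ.asModule, Function.Injective Φ := by
  apply cs.exists_injective_directSum
  intro i
  by_contra! h
  apply cs.longest_mul_simple_ne i
  apply cs.zeroHecke_injective
  apply hρ
  ext v
  have := h (ρ.asModuleEquiv.symm v)
  rw [socleGenerator, sub_smul, sub_eq_zero] at this
  rw [← Representation.asModuleEquiv_symm_map_rho, ← Representation.asModuleEquiv_symm_map_rho]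
    at this
  exact ρ.asModuleEquiv.symm.injective this

/-! ### Dimensions -/

/-- The cosets of `W_J` index the elements of `H(W) e_J`. -/
theorem ncard_range_mul_idem (J : Set B) :
    (Set.range fun h => h * cs.idem J).ncard = (cs.parabolic J).index := by
  let f : W ⧸ cs.parabolic J → ZeroHeckeMonoid M :=
    Quotient.lift (fun u => cs.zeroHecke u * cs.idem J) fun u v huv =>
      cs.zeroHecke_mul_idem_eq_iff.mpr (QuotientGroup.leftRel_apply.mp huv)
  have hf : Function.Injective f := by
    intro a b
    induction a using QuotientGroup.induction_on
    induction b using QuotientGroup.induction_on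
    intro h
    exact QuotientGroup.eq.mpr (cs.zeroHecke_mul_idem_eq_iff.mp h)
  have hr : Set.range f = Set.range fun h => h * cs.idem J := by
    ext x
    constructor
    · rintro ⟨a, rfl⟩
      induction a using QuotientGroup.induction_on with
      | H u => exact ⟨cs.zeroHecke u, rfl⟩
    · rintro ⟨h, rfl⟩
      obtain ⟨u, rfl⟩ := cs.zeroHecke_surjective h
      exact ⟨(u : W ⧸ cs.parabolic J), rfl⟩
  rw [← hr, ← Nat.card_coe_set_eq, Nat.card_range_of_injective hf, Subgroup.index]

variable (k)

/-- The differences `h - e_0`, for `h ≠ e_0` in `H(W) e_{(s)}`, form a basis of the ideal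
`k H(W) (e_{(s)} - e_0)`. -/
theorem finrank_projIdeal_add_one (i : B) :
    Module.finrank k (cs.projIdeal k i) + 1 = (cs.parabolic {i}ᶜ).index := by
  classical
  have : Finite (ZeroHeckeMonoid M) := Finite.of_surjective _ cs.zeroHecke_surjective
  set X : Set (ZeroHeckeMonoid M) := Set.range fun h => h * cs.idem {i}ᶜ with hX
  have h0 : cs.idem Set.univ ∈ X := ⟨cs.idem Set.univ, cs.idem_univ_mul _⟩
  let D : Set (ZeroHeckeMonoid M) := X \ {cs.idem Set.univ}
  let b : D → A := fun h => toA h - toA (cs.idem Set.univ)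
  have hb : LinearIndependent k b := by
    rw [linearIndependent_iff']
    intro t g hg j hj
    have h1 := congrArg (fun x : A => x.coeff j) hg
    have hj0 : cs.idem Set.univ ≠ j := fun h => j.2.2 h.symm
    simpa [b, Finsupp.single_apply, hj0, hj, Subtype.coe_inj] using h1
  have hspan : Submodule.span k (Set.range b) = (cs.projIdeal k i).restrictScalars k := by
    apply le_antisymm
    · rw [Submodule.span_le]
      rintro _ ⟨⟨_, ⟨h, rfl⟩, _⟩, rfl⟩
      refine cs.mem_projIdeal.mpr ⟨toA h, ?_⟩
      rw [mul_sub, ← map_mul, ← map_mul, mul_idem_univ]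
    · intro x hx
      obtain ⟨a, rfl⟩ := cs.mem_projIdeal.mp hx
      clear hx
      induction a using MonoidAlgebra.induction_linear with
      | zero => simp
      | add a a' ha ha' => rw [add_mul]; exact add_mem ha ha'
      | single h r =>
        have e : MonoidAlgebra.single h r * (toA (cs.idem {i}ᶜ) - toA (cs.idem Set.univ)) =
            r • (toA (h * cs.idem {i}ᶜ) - toA (cs.idem Set.univ)) := by
          simp [mul_sub, smul_sub, MonoidAlgebra.single_mul_single, mul_idem_univ]
        rw [e]
        refine Submodule.smul_mem _ _ ?_
        by_cases hh : h * cs.idem {i}ᶜ = cs.idem Set.univ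
        · rw [hh, sub_self]; exact zero_mem _
        · exact Submodule.subset_span ⟨⟨_, ⟨h, rfl⟩, hh⟩, rfl⟩
  have : Fintype D := Fintype.ofFinite D
  have hcard := finrank_span_eq_card hb
  rw [hspan] at hcard
  have hD : D.ncard + 1 = X.ncard := Set.ncard_sdiff_singleton_add_one h0
  rw [← cs.ncard_range_mul_idem, ← hX, ← hD, ← Nat.card_coe_set_eq, Nat.card_eq_fintype_card,
    ← hcard]
  rfl

theorem finite_projIdeal (i : B) : Module.Finite k (cs.projIdeal k i) := by
  have : Finite (ZeroHeckeMonoid M) := Finite.of_surjective _ cs.zeroHecke_surjective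
  have : Module.Finite k A :=
    Module.Finite.equiv (MonoidAlgebra.coeffLinearEquiv k (M := ZeroHeckeMonoid M)).symm
  exact inferInstanceAs (Module.Finite k ((cs.projIdeal k i).restrictScalars k))

theorem finrank_directSum_projIdeal [Fintype B] :
    (Module.finrank k (DirectSum B fun i => cs.projIdeal k i) : ℤ) =
      (∑ i : B, ((cs.parabolic {i}ᶜ).index : ℤ)) - Fintype.card B := by
  have := cs.finite_projIdeal k
  rw [Module.finrank_directSum, Nat.cast_sum]
  have h : ∀ i : B, ((Module.finrank k (cs.projIdeal k i) : ℕ) : ℤ) =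
      ((cs.parabolic {i}ᶜ).index : ℤ) - 1 := by
    intro i
    rw [← cs.finrank_projIdeal_add_one k i]
    push_cast
    ring
  rw [Finset.sum_congr rfl fun i _ => h i, Finset.sum_sub_distrib]
  simp

/-- The direct sum is effective: the action on the generator of the summand of `s` determines the
coset of `W_{(s)}`, and the maximal parabolic subgroups intersect trivially. -/
theorem ofModule'_directSum_injective :
    Function.Injective
      (Representation.ofModule' (k := k) (G := ZeroHeckeMonoid M)
        (DirectSum B fun i => cs.projIdeal k i)) := by
  classical
  intro g h hgh
  obtain ⟨u, rfl⟩ := cs.zeroHecke_surjective g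
  obtain ⟨v, rfl⟩ := cs.zeroHecke_surjective h
  congr 1
  rw [← inv_mul_eq_one]
  apply cs.eq_one_of_forall_mem_parabolic_compl
  intro i
  rw [← cs.zeroHecke_mul_idem_eq_iff]
  have hd : toA (cs.idem {i}ᶜ) - toA (cs.idem Set.univ) ∈ cs.projIdeal k i :=
    Submodule.subset_span rfl
  have h1 := LinearMap.congr_fun hgh (DirectSum.lof A B (fun i => cs.projIdeal k i) i ⟨_, hd⟩)
  have h2 : ∀ w : W, Representation.ofModule' (k := k) (G := ZeroHeckeMonoid M)
      (DirectSum B fun i => cs.projIdeal k i) (cs.zeroHecke w)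
        (DirectSum.lof A B (fun i => cs.projIdeal k i) i ⟨_, hd⟩) =
      DirectSum.lof A B (fun i => cs.projIdeal k i) i (toA (cs.zeroHecke w) • ⟨_, hd⟩) := by
    intro w
    rw [map_smul]
    simp [Representation.ofModule']
  rw [h2, h2] at h1
  have h3 := congrArg Subtype.val (DirectSum.of_injective i h1)
  simp only [SetLike.mk_smul_mk, smul_eq_mul, mul_sub, ← map_mul, mul_idem_univ,
    sub_left_inj] at h3
  exact MonoidAlgebra.of_injective h3

theorem hasEffectiveRepOfDim_finrank [Finite B] :
    HasEffectiveRepOfDim k (ZeroHeckeMonoid M)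
      (Module.finrank k (DirectSum B fun i => cs.projIdeal k i)) := by
  have := cs.finite_projIdeal k
  have := Fintype.ofFinite B
  let e := (Module.finBasis k (DirectSum B fun i => cs.projIdeal k i)).equivFun
  refine ⟨Fin (Module.finrank k (DirectSum B fun i => cs.projIdeal k i)) → k, inferInstance,
    inferInstance, (e.conjAlgEquiv k).toMulEquiv.toMonoidHom.comp (Representation.ofModule'
      (DirectSum B fun i => cs.projIdeal k i)), ?_, rank_fin_fun _⟩
  exact (e.conjAlgEquiv k).injective.comp (cs.ofModule'_directSum_injective k)

end CoxeterSystem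

theorem mainTheorem1 {B : Type*} {W : Type*} [Fintype B] [Group W] [Finite W]
    {M : CoxeterMatrix B} (cs : CoxeterSystem M W) (k : Type*) [Field k] :
    Module.Projective (MonoidAlgebra k (ZeroHeckeMonoid M))
        (DirectSum B fun s => cs.projIdeal k s) ∧
    (∀ (V : Type*) [AddCommGroup V] [Module k V] (ρ : Representation k (ZeroHeckeMonoid M) V),
      Function.Injective ρ →
      ∃ N : Submodule (MonoidAlgebra k (ZeroHeckeMonoid M)) ρ.asModule,
        Nonempty (N ≃ₗ[MonoidAlgebra k (ZeroHeckeMonoid M)]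
          DirectSum B fun s => cs.projIdeal k s)) ∧
    ∃ d : ℕ, (d : ℤ) = (∑ s : B, ((cs.parabolic {s}ᶜ).index : ℤ)) - Fintype.card B ∧
      IsLeast {n : ℕ | HasEffectiveRepOfDim k (ZeroHeckeMonoid M) n} d := by
  refine ⟨?_, ?_, _, cs.finrank_directSum_projIdeal k, cs.hasEffectiveRepOfDim_finrank k, ?_⟩
  · have := cs.projIdeal_projective k
    infer_instance
  · intro V _ _ ρ hρ
    obtain ⟨Φ, hΦ⟩ := cs.exists_injective_directSum_of_effective ρ hρ
    exact ⟨LinearMap.range Φ, ⟨(LinearEquiv.ofInjective Φ hΦ).symm⟩⟩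
  · rintro n ⟨V, _, _, ρ, hρ, hn⟩
    obtain ⟨Φ, hΦ⟩ := cs.exists_injective_directSum_of_effective ρ hρ
    have : Module.Finite k V := Module.finite_of_rank_eq_nat hn
    rw [← Module.finrank_eq_of_rank_eq hn]
    have h := LinearMap.finrank_le_finrank_of_injective (f := Φ.restrictScalars k) hΦ
    rwa [ρ.asModuleEquiv.finrank_eq] at h
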